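/- Let $\mathcal A^{\mathbb R}$ be the $\mathbb R$-motivic Steenrod algebra at the prime $2$: the associative unital bigraded $\mathbb F_2$-algebra generated by $\tau,\rho$ and $\mathrm{Sq}^n$ ($n\ge 0$), of cohomological bidegrees $|\tau|=(0,1)$, $|\rho|=(1,1)$, $|\mathrm{Sq}^n|=(n,\lfloor n/2\rfloor)$, subject to $\mathrm{Sq}^0=1$; $\tau\rho=\rho\tau$; $\mathrm{Sq}^n\rho=\rho\,\mathrm{Sq}^n$; $\mathrm{Sq}^{1}\tau=\tau\mathrm{Sq}^{1}+\rho$; $\mathrm{Sq}^{2n}\tau=\tau\mathrm{Sq}^{2n}+\tau\rho\,\mathrm{Sq}^{2n-1}$ and $\mathrm{Sq}^{2n+1}\tau=\tau\mathrm{Sq}^{2n+1}+\rho\,\mathrm{Sq}^{2n}+\rho^2\,\mathrm{Sq}^{2n-1}$ for $n\ge1$; and, for $0<a<2b$, the Adem relations expressing $\mathrm{Sq}^a\mathrm{Sq}^b$ as $$\begin{cases} \sum_{j=0}^{a/2}\tau^{\,j\bmod 2}\binom{b-1-j}{a-2j}\mathrm{Sq}^{a+b-j}\mathrm{Sq}^j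 & a,b\text{ even},\\ \sum_{j=0}^{(a-1)/2}\left(\binom{b-1-j}{a-2j}\mathrm{Sq}^{a+b-j}\mathrm{Sq}^j+\rho\binom{b-j}{a-2j}\mathrm{Sq}^{a+b-j-1}\mathrm{Sq}^j\right) & a\text{ odd},\ b\text{ even},\\ \sum_{j=0}^{a/2}\left(\binom{b-1-j}{a-2j}\mathrm{Sq}^{a+b-j}\mathrm{Sq}^j+\rho\binom{b-1-j}{a+1-2j}\mathrm{Sq}^{a+b-j-1}\mathrm{Sq}^j\right) & a\text{ even},\ b\text{ odd},\\ \sum_{j=0}^{(a-1)/2}\binom{b-1-j}{a-2j}\mathrm{Sq}^{a+b-j}\mathrm{Sq}^j & a,b\text{ odd}. \end{cases}$$ Put $\mathbb M_2^{\mathbb R}=\mathbb F_2[\tau,\rho]$, and let $\mathcal A^{\mathbb R}(1)\subset\mathcal A^{\mathbb R}$ be the subalgebra generated by $\tau,\rho,\mathrm{Sq}^1,\mathrm{Sq}^2$. All $\mathcal A^{\mathbb R}$-modules are bigraded left modules, and isomorphisms preserve the bigrading. In $\mathcal A^{\mathbb R}(1)$ put $$x_{0,0}=1,\quad x_{1,0}=\mathrm{Sq}^1x_{0,0},\quad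 x_{2,1}=\mathrm{Sq}^2x_{0,0},\quad x_{3,1}=\mathrm{Sq}^1x_{2,1},$$ $$y_{3,1}=\mathrm{Sq}^2x_{1,0},\quad y_{4,1}=\mathrm{Sq}^1y_{3,1},\quad y_{5,2}=\mathrm{Sq}^2x_{3,1},\quad y_{6,2}=\mathrm{Sq}^1y_{5,2}.$$ By an $\mathcal A^{\mathbb R}$-module structure on $\mathcal A^{\mathbb R}(1)$ we mean one on the bigraded group $\mathcal A^{\mathbb R}(1)$ that extends left multiplication by $\mathcal A^{\mathbb R}(1)$. **Theorem 1.4.** (a) The eight elements above form a basis of $\mathcal A^{\mathbb R}(1)$ as a left $\mathbb M_2^{\mathbb R}$-module, and $\mathrm{Sq}^2x_{2,1}=\tau y_{4,1}$, $\mathrm{Sq}^2y_{4,1}=y_{6,2}$. (b) For every vector $\overline{v}=(\alpha_{03},\beta_{03},\beta_{14},\beta_{06},\beta_{25},\beta_{26},\gamma_{36})\in\mathbb F_2^7$, with $j_{24}=\beta_{03}\gamma_{36}+\alpha_{03}(\beta_{25}+\beta_{26})$, there is exactly one $\mathcal A^{\mathbb R}$-module structure on $\mathcal A^{\mathbb R}(1)$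 such that - (i) $\mathrm{Sq}^4(x_{0,0})=\beta_{03}(\rho\, y_{3,1})+(1+\beta_{03}+\beta_{14})(\tau\, y_{4,1})+\alpha_{03}(\rho\, x_{3,1})$, - (ii) $\mathrm{Sq}^4(x_{1,0})=y_{5,2}+\beta_{14}(\rho\, y_{4,1})$, - (iii) $\mathrm{Sq}^4(x_{2,1})=\beta_{26}(\tau\, y_{6,2})+\beta_{25}(\rho\, y_{5,2})+j_{24}(\rho^2 y_{4,1})$, - (iv) $\mathrm{Sq}^4(x_{3,1})=(\beta_{25}+\beta_{26})(\rho\, y_{6,2})$, - (v) $\mathrm{Sq}^4(y_{3,1})=\gamma_{36}(\rho\, y_{6,2})$, - (vi) $\mathrm{Sq}^8(x_{0,0})=\beta_{06}(\rho^2 y_{6,2})$. (c) The $128$ modules obtained in this way are pairwise non-isomorphic. (d) Every $\mathcal A^{\mathbb R}$-module whose underlying $\mathcal A^{\mathbb R}(1)$-module is free on one homogeneous generator, of bidegree $s\in\mathbb Z^2$ say, is isomorphic to the suspension $\Sigma^{s}$ of one of them (so to one of them itself if $s=(0,0)$). -/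

import Mathlib

namespace RMotivic

/-! ### The `ℝ`-motivic Steenrod algebra -/

/-- Generators of the `ℝ`-motivic Steenrod algebra: the two polynomial generators of the
coefficient ring `𝔽₂[τ, ρ]`, and the squares `Sq^n` for `n ≥ 0`. -/
inductive Gen : Type
  | tau : Gen
  | rho : Gen
  | sq (n : ℕ) : Gen

/-- The cohomological bidegree (topological degree, weight):
`|τ| = (0, 1)`, `|ρ| = (1, 1)`, `|Sq^n| = (n, ⌊n / 2⌋)`. -/
def Gen.degree : Gen → ℤ × ℤ
  | .tau => (0, 1)
  | .rho => (1, 1)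
  | .sq n => ((n : ℤ), ((n / 2 : ℕ) : ℤ))

/-- The free associative `𝔽₂`-algebra on `τ`, `ρ` and the `Sq^n`. -/
abbrev Words : Type := FreeAlgebra (ZMod 2) Gen

/-- `τ` in the free algebra. -/
abbrev wTau : Words := FreeAlgebra.ι (ZMod 2) Gen.tau

/-- `ρ` in the free algebra. -/
abbrev wRho : Words := FreeAlgebra.ι (ZMod 2) Gen.rho

/-- `Sq^n` in the free algebra. -/
abbrev wSq (n : ℕ) : Words := FreeAlgebra.ι (ZMod 2) (Gen.sq n)

/-- The right-hand side of the `ℝ`-motivic Adem relation for `Sq^a Sq^b`, meant for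
`0 < a < 2 b`. (In that range `j ≤ a / 2 < b`, so no subtraction truncates.) -/
def ademRHS (a b : ℕ) : Words :=
  if Even a then
    if Even b then
      ∑ j ∈ Finset.range (a / 2 + 1),
        (b - 1 - j).choose (a - 2 * j) • (wTau ^ (j % 2) * wSq (a + b - j) * wSq j)
    else
      ∑ j ∈ Finset.range (a / 2 + 1),
        ((b - 1 - j).choose (a - 2 * j) • (wSq (a + b - j) * wSq j) +
          (b - 1 - j).choose (a + 1 - 2 * j) • (wRho * wSq (a + b - j - 1) * wSq j))
  else
    if Even b then
      ∑ j ∈ Finset.range ((a - 1) / 2 + 1),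
        ((b - 1 - j).choose (a - 2 * j) • (wSq (a + b - j) * wSq j) +
          (b - j).choose (a - 2 * j) • (wRho * wSq (a + b - j - 1) * wSq j))
    else
      ∑ j ∈ Finset.range ((a - 1) / 2 + 1),
        (b - 1 - j).choose (a - 2 * j) • (wSq (a + b - j) * wSq j)

/-- The defining relations of the `ℝ`-motivic Steenrod algebra. The ring `𝔽₂[τ, ρ]` is
commutative but not central: the relations between `Sq^n` and the coefficients are the Cartan
formula together with `Sq^1 τ = ρ`, `Sq^n τ = 0` for `n ≥ 2` and `Sq^n ρ = 0` for `n ≥ 1`. -/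
inductive SteenrodRel : Words → Words → Prop
  | tau_rho : SteenrodRel (wTau * wRho) (wRho * wTau)
  | sq_zero : SteenrodRel (wSq 0) 1
  | sq_rho (n : ℕ) : SteenrodRel (wSq n * wRho) (wRho * wSq n)
  | sq_even_tau (n : ℕ) :
      SteenrodRel (wSq (2 * n + 2) * wTau) (wTau * wSq (2 * n + 2) + wTau * wRho * wSq (2 * n + 1))
  | sq_one_tau : SteenrodRel (wSq 1 * wTau) (wTau * wSq 1 + wRho)
  | sq_odd_tau (n : ℕ) :
      SteenrodRel (wSq (2 * n + 3) * wTau)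
        (wTau * wSq (2 * n + 3) + wRho * wSq (2 * n + 2) + wRho ^ 2 * wSq (2 * n + 1))
  | adem (a b : ℕ) (ha : 0 < a) (hab : a < 2 * b) : SteenrodRel (wSq a * wSq b) (ademRHS a b)

/-- The `ℝ`-motivic Steenrod algebra `𝒜^ℝ`. -/
def AR : Type := RingQuot SteenrodRel

noncomputable instance : Ring AR := inferInstanceAs (Ring (RingQuot SteenrodRel))

noncomputable instance : Algebra (ZMod 2) AR :=
  inferInstanceAs (Algebra (ZMod 2) (RingQuot SteenrodRel))

/-- The class of a generator in `𝒜^ℝ`. -/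
noncomputable def gen (g : Gen) : AR :=
  RingQuot.mkAlgHom (ZMod 2) SteenrodRel (FreeAlgebra.ι (ZMod 2) g)

/-- The operation `Sq^n` in `𝒜^ℝ`. -/
noncomputable def Sq (n : ℕ) : AR := gen (.sq n)

/-- The homogeneous elements of `𝒜^ℝ` of bidegree `d`: sums of products of generators whose
bidegrees add up to `d`. -/
noncomputable def AR.homogeneous (d : ℤ × ℤ) : AddSubgroup AR :=
  AddSubgroup.closure
    {x | ∃ l : List Gen, (l.map Gen.degree).sum = d ∧ (l.map gen).prod = x}

/-! ### Bigraded modules -/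

/-- The subgroups `ℳ (n, w)` make the left `𝒜^ℝ`-module `M` a bigraded left `𝒜^ℝ`-module:
`M` is their direct sum, and every generator of `𝒜^ℝ` raises bidegrees by its own bidegree. -/
structure IsBigraded {M : Type*} [AddCommGroup M] [Module AR M]
    (ℳ : ℤ × ℤ → AddSubgroup M) : Prop where
  isInternal : DirectSum.IsInternal ℳ
  gen_smul_mem : ∀ (g : Gen) (d : ℤ × ℤ) (m : M), m ∈ ℳ d → gen g • m ∈ ℳ (d + g.degree)

/-- `N` (with bigrading `𝒩`) is isomorphic, as a bigraded `𝒜^ℝ`-module, to the suspension by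
`s` of `M` (with bigrading `ℳ`). For `s = 0` this is isomorphism of bigraded modules. -/
def IsoSuspension {M N : Type*} [AddCommGroup M] [Module AR M] [AddCommGroup N] [Module AR N]
    (s : ℤ × ℤ) (ℳ : ℤ × ℤ → AddSubgroup M) (𝒩 : ℤ × ℤ → AddSubgroup N) : Prop :=
  ∃ e : M ≃ₗ[AR] N, ∀ (d : ℤ × ℤ) (m : M), m ∈ ℳ d ↔ e m ∈ 𝒩 (d + s)

/-! ### The subalgebra `𝒜^ℝ(1)` and its basis -/

/-- `𝒜^ℝ(1)`: the subalgebra of `𝒜^ℝ` generated over `𝔽₂[τ, ρ]` by `Sq^1` and `Sq^2`. -/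
noncomputable def AR1 : Subalgebra (ZMod 2) AR :=
  Algebra.adjoin (ZMod 2) {gen .tau, gen .rho, Sq 1, Sq 2}

namespace AR1

/-- The bigrading of `𝒜^ℝ(1)` inherited from `𝒜^ℝ`. -/
noncomputable def homogeneous (d : ℤ × ℤ) : AddSubgroup AR1 :=
  (AR.homogeneous d).comap (AR1.val : AR1 →+ AR)

/-- `τ` as an element of `𝒜^ℝ(1)`. -/
noncomputable def τ : AR1 := ⟨gen .tau, Algebra.subset_adjoin (by simp)⟩

/-- `ρ` as an element of `𝒜^ℝ(1)`. -/
noncomputable def ρ : AR1 := ⟨gen .rho, Algebra.subset_adjoin (by simp)⟩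

/-- `Sq^1` as an element of `𝒜^ℝ(1)`. -/
noncomputable def sq1 : AR1 := ⟨Sq 1, Algebra.subset_adjoin (by simp)⟩

/-- `Sq^2` as an element of `𝒜^ℝ(1)`. -/
noncomputable def sq2 : AR1 := ⟨Sq 2, Algebra.subset_adjoin (by simp)⟩

/-- `x_{0,0} = 1`. -/
noncomputable def x00 : AR1 := 1

/-- `x_{1,0} = Sq^1 x_{0,0}`. -/
noncomputable def x10 : AR1 := sq1 * x00

/-- `x_{2,1} = Sq^2 x_{0,0}`. -/
noncomputable def x21 : AR1 := sq2 * x00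

/-- `x_{3,1} = Sq^1 x_{2,1}`. -/
noncomputable def x31 : AR1 := sq1 * x21

/-- `y_{3,1} = Sq^2 x_{1,0}`. -/
noncomputable def y31 : AR1 := sq2 * x10

/-- `y_{4,1} = Sq^1 y_{3,1}`. -/
noncomputable def y41 : AR1 := sq1 * y31

/-- `y_{5,2} = Sq^2 x_{3,1}`. -/
noncomputable def y52 : AR1 := sq2 * x31

/-- `y_{6,2} = Sq^1 y_{5,2}`. -/
noncomputable def y62 : AR1 := sq1 * y52

/-- The eight elements `x_{0,0}, x_{1,0}, x_{2,1}, x_{3,1}, y_{3,1}, y_{4,1}, y_{5,2}, y_{6,2}`. -/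
noncomputable def basis : Fin 8 → AR1 := ![x00, x10, x21, x31, y31, y41, y52, y62]

end AR1

/-- A family `b` is a basis of `𝒜^ℝ(1)` as a left module over `𝔽₂[τ, ρ]`: the products
`τ^k ρ^l b_i` form a basis over `𝔽₂`. -/
def IsCoefficientBasis {ι : Type*} (b : ι → AR1) : Prop :=
  LinearIndependent (ZMod 2) (fun p : ι × ℕ × ℕ => AR1.τ ^ p.2.1 * AR1.ρ ^ p.2.2 * b p.1) ∧
    Submodule.span (ZMod 2)
      (Set.range fun p : ι × ℕ × ℕ => AR1.τ ^ p.2.1 * AR1.ρ ^ p.2.2 * b p.1) = ⊤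

/-- `M` is free of rank one over `𝒜^ℝ(1)` on a homogeneous generator of bidegree `s`. -/
def IsFreeOnOneGenerator {M : Type*} [AddCommGroup M] [Module AR M]
    (ℳ : ℤ × ℤ → AddSubgroup M) (s : ℤ × ℤ) : Prop :=
  ∃ g ∈ ℳ s, Function.Bijective (fun a : AR1 => (a : AR) • g)

/-! ### `𝒜^ℝ`-module structures on `𝒜^ℝ(1)` -/

/-- An `𝒜^ℝ`-module structure on `𝒜^ℝ(1)`: a bigraded left `𝒜^ℝ`-module structure on the
bigraded group `𝒜^ℝ(1)` that extends left multiplication by elements of `𝒜^ℝ(1)`. -/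
structure ModuleStructure where
  module : Module AR AR1
  smul_eq_mul : ∀ a b : AR1, (a : AR) • b = a * b
  isBigraded : IsBigraded AR1.homogeneous

/-- The underlying group `𝒜^ℝ(1)`, remembering the module structure `S`. -/
def ModuleStructure.Carrier (_S : ModuleStructure) : Type := AR1

noncomputable instance (S : ModuleStructure) : AddCommGroup S.Carrier :=
  inferInstanceAs (AddCommGroup AR1)

noncomputable instance (S : ModuleStructure) : Module AR S.Carrier := S.module

/-- The bigrading of `𝒜^ℝ(1)`, on the module given by `S`. -/
noncomputable def ModuleStructure.grading (S : ModuleStructure) :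
    ℤ × ℤ → AddSubgroup S.Carrier := AR1.homogeneous

/-- The action of `𝒜^ℝ` on `𝒜^ℝ(1)` given by `S`. -/
noncomputable def ModuleStructure.act (S : ModuleStructure) (a : AR) (x : AR1) : AR1 :=
  S.module.smul a x

open AR1 in
/-- The formulas for `Sq^4` and `Sq^8` attached to
`(α₀₃, β₀₃, β₁₄, β₀₆, β₂₅, β₂₆, γ₃₆)`. -/
structure Formulas (α₀₃ β₀₃ β₁₄ β₀₆ β₂₅ β₂₆ γ₃₆ : ZMod 2) (S : ModuleStructure) : Prop where
  sq4_x00 : S.act (Sq 4) x00 =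
    β₀₃ • (ρ * y31) + (1 + β₀₃ + β₁₄) • (τ * y41) + α₀₃ • (ρ * x31)
  sq4_x10 : S.act (Sq 4) x10 = y52 + β₁₄ • (ρ * y41)
  sq4_x21 : S.act (Sq 4) x21 =
    β₂₆ • (τ * y62) + β₂₅ • (ρ * y52) + (β₀₃ * γ₃₆ + α₀₃ * (β₂₅ + β₂₆)) • (ρ ^ 2 * y41)
  sq4_x31 : S.act (Sq 4) x31 = (β₂₅ + β₂₆) • (ρ * y62)
  sq4_y31 : S.act (Sq 4) y31 = γ₃₆ • (ρ * y62)
  sq8_x00 : S.act (Sq 8) x00 = β₀₆ • (ρ ^ 2 * y62)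

/-- `S` satisfies the formulas of the vector `v = (α₀₃, β₀₃, β₁₄, β₀₆, β₂₅, β₂₆, γ₃₆)`. -/
def Listed (v : Fin 7 → ZMod 2) (S : ModuleStructure) : Prop :=
  Formulas (v 0) (v 1) (v 2) (v 3) (v 4) (v 5) (v 6) S

end RMotivic

/-!
The squares `Sq^{2k+1}` equal `Sq^1 Sq^{2k}`, so an action of the Steenrod algebra is given by
operators `d = Sq^1` and `s k = Sq^{2k}`. In terms of these, the defining relations amount to the
commutation rules with `τ` and `ρ` (`CartanRelations`) and to the Adem relations for
`Sq^{2p} Sq^{2q}` and `Sq^{2p} Sq^{2q+1}` (`CartanRelations.wordValue_eq`).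

The failure of an Adem relation, composed with `τ`, is a combination of failures of Adem relations
composed with coefficients and `Sq^1` on the other side (`CartanRelations.evenEven_tau`,
`CartanRelations.evenOdd_tau`, which rest on Pascal's rule and a telescoping sum). On a module that
is free over `𝔽₂[τ, ρ]` the Adem relations therefore need to be checked on the generators only. For
the module with eight generators in the bidegrees of the basis of `𝒜^ℝ(1)`, the difference of
topological degree and weight lies between `0` and `4` on the generators, is not changed by `ρ` and
is lowered by `τ`. So nearly all relations hold for degree reasons, and the remaining few are
checked directly (`Free8.ademAt_e`). This yields, for every vector `v`, a module `Model v` in which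
`Sq^4` and `Sq^8` have the prescribed values.

The relations in `𝒜^ℝ(1)` show that the eight elements span it over the coefficients, and evaluation
at the generator of a model shows that they are independent. Hence every model is free on one
generator over `𝒜^ℝ(1)`, and its structure transports to `𝒜^ℝ(1)` (`exists_moduleStructure`).

By the Cartan formula and degree reasons, a module structure on `𝒜^ℝ(1)` is determined by the values
of `Sq^4` on five of the basis elements and of `Sq^8` on the first one (`Free8.eq_action`). Degree
reasons leave eleven coefficients in these values, and the Adem relations for `Sq^2 Sq^3`,
`Sq^4 Sq^3` and `Sq^4 Sq^4` on the generator express four of them through the other seven, in the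
way prescribed by the formulas (`ModuleStructure.exists_listed`). Finally, `1` is the only nonzero
element of `𝒜^ℝ(1)` of bidegree `(0, 0)`, so an isomorphism between two structures is the identity
(`ModuleStructure.eq_of_isoSuspension`).
-/

namespace RMotivic

/-! ### Binomial coefficients modulo 2 -/

/-- The binomial coefficient `m.choose k` modulo `2`, for integers `m` and `k`; it vanishes for
`k < 0`, and negative `m` are allowed, so that Pascal's rule holds without exception. -/
def bin (m k : ℤ) : ZMod 2 := if 0 ≤ k then ((Ring.choose m k.toNat : ℤ) : ZMod 2) else 0

lemma bin_of_neg {m k : ℤ} (hk : k < 0) : bin m k = 0 := if_neg (by omega)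

lemma bin_natCast (m k : ℕ) : bin m k = (m.choose k : ZMod 2) := by
  simp [bin, Ring.choose_natCast]

lemma bin_pascal (m k : ℤ) : bin (m + 1) k = bin m k + bin m (k - 1) := by
  rcases lt_trichotomy k 0 with hk | rfl | hk
  · rw [bin_of_neg hk, bin_of_neg hk, bin_of_neg (by omega), add_zero]
  · rw [bin_of_neg (k := 0 - 1) (by omega)]
    simp [bin]
  · obtain ⟨j, rfl⟩ : ∃ j : ℕ, k = j + 1 := ⟨(k - 1).toNat, by omega⟩
    have h1 : ((j : ℤ) + 1).toNat = j + 1 := by omega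
    have h2 : ((j : ℤ) + 1 - 1).toNat = j := by omega
    rw [bin, bin, bin, if_pos (by omega), if_pos (by omega), if_pos (by omega), h1, h2,
      Ring.choose_succ_succ]
    push_cast
    ring

/-! ### Conjugating the Adem relations by `τ` -/

/-- The part of the relations of `𝒜^ℝ` that governs how the even squares `s k = Sq^{2k}` and
`d = Sq^1` interact with `τ` and `ρ`, for elements of an arbitrary `𝔽₂`-algebra. The index `k` is
an integer and `s k = 0` for `k < 0`. -/
structure CartanRelations {R : Type*} [Ring R] (τ ρ d : R) (s : ℤ → R) : Prop where
  tau_rho : τ * ρ = ρ * τ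
  d_rho : d * ρ = ρ * d
  s_rho (k : ℤ) : s k * ρ = ρ * s k
  d_tau : d * τ = τ * d + ρ
  d_d : d * d = 0
  s_tau (k : ℤ) : s k * τ = τ * s k + τ * ρ * d * s (k - 1)
  s_neg (k : ℤ) (hk : k < 0) : s k = 0
  s_zero : s 0 = 1

namespace CartanRelations

variable {R : Type*} [Ring R] {τ ρ d : R} {s : ℤ → R}

lemma s_rho_mul (h : CartanRelations τ ρ d s) (k : ℤ) (x : R) :
    s k * (ρ * x) = ρ * (s k * x) := by
  rw [← mul_assoc, h.s_rho, mul_assoc]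

lemma d_rho_mul (h : CartanRelations τ ρ d s) (x : R) : d * (ρ * x) = ρ * (d * x) := by
  rw [← mul_assoc, h.d_rho, mul_assoc]

lemma tau_rho_mul (h : CartanRelations τ ρ d s) (x : R) : τ * (ρ * x) = ρ * (τ * x) := by
  rw [← mul_assoc, h.tau_rho, mul_assoc]

lemma s_tau' (h : CartanRelations τ ρ d s) (k : ℤ) :
    s k * τ = τ * s k + ρ * (τ * (d * s (k - 1))) := by
  rw [h.s_tau, h.tau_rho]
  simp only [mul_assoc]

lemma s_tau_mul (h : CartanRelations τ ρ d s) (k : ℤ) (x : R) :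
    s k * (τ * x) = τ * (s k * x) + ρ * (τ * (d * (s (k - 1) * x))) := by
  rw [← mul_assoc, h.s_tau', add_mul]
  simp only [mul_assoc]

lemma d_tau_mul (h : CartanRelations τ ρ d s) (x : R) : d * (τ * x) = τ * (d * x) + ρ * x := by
  rw [← mul_assoc, h.d_tau, add_mul, mul_assoc]

lemma d_d_mul (h : CartanRelations τ ρ d s) (x : R) : d * (d * x) = 0 := by
  rw [← mul_assoc, h.d_d, zero_mul]

end CartanRelations

section

variable {R : Type*} [Ring R] [Algebra (ZMod 2) R] (τ ρ d : R) (s : ℤ → R)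

/-- The right-hand side of the Adem relation for `Sq^{2p} Sq^{2q}`, in terms of `d` and `s`; the
parameter `N` bounds the summation, and the value does not depend on it once `p < N`. -/
def evenEven (N : ℕ) (p q : ℤ) : R :=
  ∑ i ∈ Finset.range N,
    (bin (q - 1 - i) (p - 2 * i) • (s (p + q - i) * s i) +
      bin (q - 1 - i) (p - 1 - 2 * i) • (τ * d * s (p + q - 1 - i) * d * s i))

/-- The right-hand side of the Adem relation for `Sq^{2p} Sq^{2q+1}`, in terms of `d` and `s`,
with the same role of `N`. -/
def evenOdd (N : ℕ) (p q : ℤ) : R :=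
  ∑ i ∈ Finset.range N,
    (bin (q - i) (p - 2 * i) • (d * s (p + q - i) * s i) +
      bin (q - 1 - i) (p - 1 - 2 * i) •
        (s (p + q - i) * d * s i + ρ * d * s (p + q - 1 - i) * d * s i))

variable {τ ρ d s}

/-- The failure of the Adem relation for `Sq^{2p} Sq^{2q}`, composed with `τ` on the right, is a
combination of failures of Adem relations composed with coefficients and `Sq^1` on the left. -/
lemma CartanRelations.evenEven_tau (h : CartanRelations τ ρ d s) {N : ℕ} {p q : ℤ} (hN : p < N) :
    (s p * s q - evenEven τ d s N p q) * τ =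
      τ * (s p * s q - evenEven τ d s N p q) +
        τ * ρ * (s p * d * s (q - 1) - evenOdd ρ d s N p (q - 1)) +
        τ * ρ * d * (s (p - 1) * s q - evenEven τ d s N (p - 1) q) +
        τ * ρ * ρ * d * (s (p - 1) * d * s (q - 1) - evenOdd ρ d s N (p - 1) (q - 1)) := by
  -- the summands on both sides differ by the telescoping differences of `g`
  let g : ℕ → R := fun i =>
    bin (q - 1 - i) (p - 2 * i) • (τ * ρ * (s (p + q - i) * d * s (i - 1)) +
        τ * ρ * ρ * (d * s (p + q - 1 - i) * d * s (i - 1))) +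
      bin (q - 1 - i) (p - 1 - 2 * i) • (τ * ρ * ρ * (d * s (p + q - 1 - i) * d * s (i - 1)))
  have hg0 : g 0 = 0 := by simp [g, h.s_neg]
  have hgN : g N = 0 := by
    simp only [g]
    rw [bin_of_neg (by omega), bin_of_neg (by omega)]; simp
  have key : evenEven τ d s N p q * τ =
      τ * evenEven τ d s N p q + τ * ρ * evenOdd ρ d s N p (q - 1) +
        τ * ρ * d * evenEven τ d s N (p - 1) q +
        τ * ρ * ρ * d * evenOdd ρ d s N (p - 1) (q - 1) := by
    rw [← sub_eq_zero, ← sub_eq_zero.2 (hgN.trans hg0.symm), ← Finset.sum_range_sub g]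
    simp only [evenEven, evenOdd, Finset.mul_sum, Finset.sum_mul, ← Finset.sum_add_distrib,
      ← Finset.sum_sub_distrib]
    refine Finset.sum_congr rfl fun i _ => ?_
    have pB : bin (q - 1 - i) (p - 1 - 2 * i) =
        bin (q - 2 - i) (p - 1 - 2 * i) + bin (q - 2 - i) (p - 2 - 2 * i) := by
      rw [show q - 1 - (i : ℤ) = q - 2 - i + 1 by ring, bin_pascal]
      congr 2; ring
    have pC : bin (q - 1 - i) (p - 2 - 2 * i) =
        bin (q - 2 - i) (p - 2 - 2 * i) + bin (q - 2 - i) (p - 3 - 2 * i) := by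
      rw [show q - 1 - (i : ℤ) = q - 2 - i + 1 by ring, bin_pascal]
      congr 2; ring
    simp only [g, Nat.cast_add, Nat.cast_one,
      show q - 1 - 1 - (i : ℤ) = q - 2 - i by ring,
      show p - 1 - 1 - 2 * (i : ℤ) = p - 2 - 2 * i by ring,
      show q - 1 - ((i : ℤ) + 1) = q - 2 - i by ring,
      show p - 2 * ((i : ℤ) + 1) = p - 2 - 2 * i by ring,
      show p - 1 - 2 * ((i : ℤ) + 1) = p - 3 - 2 * i by ring,
      show p + (q - 1) - (i : ℤ) = p + q - 1 - i by ring,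
      show p - 1 + q - (i : ℤ) = p + q - 1 - i by ring,
      show p + q - ((i : ℤ) + 1) = p + q - 1 - i by ring,
      show p + (q - 1) - 1 - (i : ℤ) = p + q - 2 - i by ring,
      show p - 1 + q - 1 - (i : ℤ) = p + q - 2 - i by ring,
      show p - 1 + (q - 1) - (i : ℤ) = p + q - 2 - i by ring,
      show p - 1 + (q - 1) - 1 - (i : ℤ) = p + q - 3 - i by ring,
      show p + q - 1 - ((i : ℤ) + 1) = p + q - 2 - i by ring,
      show (i : ℤ) + 1 - 1 = i by ring]
    simp only [pB, pC, mul_add, add_mul, mul_smul_comm, smul_mul_assoc, mul_assoc, h.s_rho_mul,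
      h.d_rho_mul, h.tau_rho_mul, h.s_tau_mul, h.s_tau', h.d_tau_mul, h.d_d_mul, smul_add,
      mul_zero, smul_zero, add_zero, zero_add,
      show p + q - 1 - (i : ℤ) - 1 = p + q - 2 - i by ring,
      show p + q - (i : ℤ) - 1 = p + q - 1 - i by ring]
    generalize bin (q - 1 - i) (p - 2 * i) = A
    generalize bin (q - 2 - i) (p - 1 - 2 * i) = B
    generalize bin (q - 2 - i) (p - 2 - 2 * i) = C
    generalize bin (q - 2 - i) (p - 3 - 2 * i) = F
    match_scalars <;> (revert A B C F; decide)
  rw [sub_mul, key]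
  simp only [mul_sub, mul_assoc, h.s_rho_mul, h.tau_rho_mul, h.s_tau_mul,
    h.s_tau', mul_add]
  match_scalars <;> decide

/-- The analogue of `CartanRelations.evenEven_tau` for `Sq^{2p} Sq^{2q+1}`. -/
lemma CartanRelations.evenOdd_tau (h : CartanRelations τ ρ d s) {N : ℕ} {p q : ℤ} (hN : p < N) :
    (s p * d * s q - evenOdd ρ d s N p q) * τ =
      τ * (s p * d * s q - evenOdd ρ d s N p q) +
        τ * ρ * d * (s (p - 1) * d * s q - evenOdd ρ d s N (p - 1) q) +
        ρ * (s p * s q - evenEven τ d s N p q) +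
        ρ * ρ * (s p * d * s (q - 1) - evenOdd ρ d s N p (q - 1)) := by
  -- the summands on both sides differ by the telescoping differences of `g`
  let g : ℕ → R := fun i =>
    bin (q - i) (p - 2 * i) • (τ * ρ * (d * s (p + q - i) * d * s (i - 1)) +
        ρ * ρ * (s (p + q - i) * d * s (i - 1)) +
        ρ * ρ * ρ * (d * s (p + q - 1 - i) * d * s (i - 1))) +
      bin (q - 1 - i) (p - 1 - 2 * i) • (ρ * ρ * (s (p + q - i) * d * s (i - 1)) +
        ρ * ρ * ρ * (d * s (p + q - 1 - i) * d * s (i - 1)))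
  have hg0 : g 0 = 0 := by simp [g, h.s_neg]
  have hgN : g N = 0 := by
    simp only [g]
    rw [bin_of_neg (by omega), bin_of_neg (by omega)]; simp
  have key : evenOdd ρ d s N p q * τ =
      τ * evenOdd ρ d s N p q + τ * ρ * d * evenOdd ρ d s N (p - 1) q +
        ρ * evenEven τ d s N p q + ρ * ρ * evenOdd ρ d s N p (q - 1) := by
    rw [← sub_eq_zero, ← sub_eq_zero.2 (hgN.trans hg0.symm), ← Finset.sum_range_sub g]
    simp only [evenEven, evenOdd, Finset.mul_sum, Finset.sum_mul, ← Finset.sum_add_distrib,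
      ← Finset.sum_sub_distrib]
    refine Finset.sum_congr rfl fun i _ => ?_
    have pP : bin (q - i) (p - 2 * i) =
        bin (q - 1 - i) (p - 2 * i) + bin (q - 1 - i) (p - 1 - 2 * i) := by
      rw [show q - (i : ℤ) = q - 1 - i + 1 by ring, bin_pascal]
      congr 2; ring
    have pQ : bin (q - i) (p - 1 - 2 * i) =
        bin (q - 1 - i) (p - 1 - 2 * i) + bin (q - 1 - i) (p - 2 - 2 * i) := by
      rw [show q - (i : ℤ) = q - 1 - i + 1 by ring, bin_pascal]
      congr 2; ring
    have pB : bin (q - 1 - i) (p - 1 - 2 * i) =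
        bin (q - 2 - i) (p - 1 - 2 * i) + bin (q - 2 - i) (p - 2 - 2 * i) := by
      rw [show q - 1 - (i : ℤ) = q - 2 - i + 1 by ring, bin_pascal]
      congr 2; ring
    have pC : bin (q - 1 - i) (p - 2 - 2 * i) =
        bin (q - 2 - i) (p - 2 - 2 * i) + bin (q - 2 - i) (p - 3 - 2 * i) := by
      rw [show q - 1 - (i : ℤ) = q - 2 - i + 1 by ring, bin_pascal]
      congr 2; ring
    simp only [g, Nat.cast_add, Nat.cast_one,
      show q - 1 - 1 - (i : ℤ) = q - 2 - i by ring,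
      show p - 1 - 1 - 2 * (i : ℤ) = p - 2 - 2 * i by ring,
      show q - ((i : ℤ) + 1) = q - 1 - i by ring,
      show q - 1 - ((i : ℤ) + 1) = q - 2 - i by ring,
      show p - 2 * ((i : ℤ) + 1) = p - 2 - 2 * i by ring,
      show p - 1 - 2 * ((i : ℤ) + 1) = p - 3 - 2 * i by ring,
      show p + (q - 1) - (i : ℤ) = p + q - 1 - i by ring,
      show p - 1 + q - (i : ℤ) = p + q - 1 - i by ring,
      show p + q - ((i : ℤ) + 1) = p + q - 1 - i by ring,
      show p + (q - 1) - 1 - (i : ℤ) = p + q - 2 - i by ring,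
      show p - 1 + q - 1 - (i : ℤ) = p + q - 2 - i by ring,
      show p + q - 1 - ((i : ℤ) + 1) = p + q - 2 - i by ring,
      show (i : ℤ) + 1 - 1 = i by ring]
    simp only [pP, pQ, pB, pC, mul_add, add_mul, mul_smul_comm, smul_mul_assoc, mul_assoc,
      h.s_rho_mul, h.d_rho_mul, h.tau_rho_mul, h.s_tau_mul, h.s_tau', h.d_tau_mul, h.d_d_mul,
      smul_add, mul_zero, smul_zero, add_zero, zero_add,
      show p + q - 1 - (i : ℤ) - 1 = p + q - 2 - i by ring,
      show p + q - (i : ℤ) - 1 = p + q - 1 - i by ring]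
    generalize bin (q - 1 - i) (p - 2 * i) = A
    generalize bin (q - 2 - i) (p - 1 - 2 * i) = B
    generalize bin (q - 2 - i) (p - 2 - 2 * i) = C
    generalize bin (q - 2 - i) (p - 3 - 2 * i) = F
    match_scalars <;> (revert A B C F; decide)
  rw [sub_mul, key]
  simp only [mul_sub, mul_assoc, h.s_rho_mul, h.tau_rho_mul, h.d_rho_mul, h.s_tau_mul,
    h.d_tau_mul, h.d_d_mul, h.s_tau', mul_add, mul_zero]
  match_scalars <;> decide

end
/-! ### Adem relations on `τ`-multiples -/

lemma bin_of_lt {m k : ℤ} (hm : 0 ≤ m) (hk : m < k) : bin m k = 0 := by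
  lift m to ℕ using hm
  lift k to ℕ using by omega
  rw [bin_natCast, Nat.choose_eq_zero_of_lt (by exact_mod_cast hk), Nat.cast_zero]

lemma bin_zero_right (m : ℤ) : bin m 0 = 1 := by simp [bin]

section

variable {R : Type*} [Ring R] [Algebra (ZMod 2) R] {τ ρ d : R} {s : ℤ → R}

lemma evenEven_of_neg {N : ℕ} {p q : ℤ} (hp : p < 0) : evenEven τ d s N p q = 0 :=
  Finset.sum_eq_zero fun i _ => by rw [bin_of_neg (by omega), bin_of_neg (by omega)]; simp

lemma evenOdd_of_neg {N : ℕ} {p q : ℤ} (hp : p < 0) : evenOdd ρ d s N p q = 0 :=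
  Finset.sum_eq_zero fun i _ => by rw [bin_of_neg (by omega), bin_of_neg (by omega)]; simp

lemma evenEven_zero {N : ℕ} (hN : 0 < N) (q : ℤ) : evenEven τ d s N 0 q = s q * s 0 := by
  rw [evenEven, Finset.sum_eq_single_of_mem 0 (Finset.mem_range.2 hN)]
  · simp [bin_zero_right, bin_of_neg]
  · intro i _ hi
    rw [bin_of_neg (by omega), bin_of_neg (by omega)]; simp

lemma evenOdd_zero {N : ℕ} (hN : 0 < N) (q : ℤ) : evenOdd ρ d s N 0 q = d * s q * s 0 := by
  rw [evenOdd, Finset.sum_eq_single_of_mem 0 (Finset.mem_range.2 hN)]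
  · simp [bin_zero_right, bin_of_neg]
  · intro i _ hi
    rw [bin_of_neg (by omega), bin_of_neg (by omega)]; simp

/-! At and just beyond the boundary of the range of the Adem relations, all but one or two terms of
the sums `evenEven` and `evenOdd` vanish. -/

lemma evenEven_boundary {N q : ℕ} (hN : q < N) :
    evenEven τ d s N (2 * q) q = s (2 * q) * s q := by
  rw [evenEven, Finset.sum_eq_single_of_mem q (Finset.mem_range.2 hN)]
  · rw [sub_self, bin_zero_right, bin_of_neg (by omega)]
    simp
  · intro i _ hi
    rcases lt_or_gt_of_ne hi with hi | hi
    · rw [bin_of_lt (by omega) (by omega), bin_of_lt (by omega) (by omega)]; simp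
    · rw [bin_of_neg (by omega), bin_of_neg (by omega)]; simp

lemma evenEven_boundary_pred {N q : ℕ} (hN : q < N) :
    evenEven τ d s N (2 * q + 1) (q + 1) = τ * d * s (2 * q + 1) * d * s q := by
  rw [evenEven, Finset.sum_eq_single_of_mem q (Finset.mem_range.2 hN)]
  · rw [bin_of_lt (k := 2 * q + 1 - 2 * q) (by omega) (by omega),
      show (2 * q + 1 - 1 - 2 * q : ℤ) = 0 by ring, bin_zero_right,
      show (2 * q + 1 + (q + 1) - 1 - q : ℤ) = 2 * q + 1 by ring]
    simp
  · intro i _ hi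
    rcases lt_or_gt_of_ne hi with hi | hi
    · rw [bin_of_lt (by omega) (by omega), bin_of_lt (by omega) (by omega)]; simp
    · rw [bin_of_neg (by omega), bin_of_neg (by omega)]; simp

lemma evenOdd_boundary {N q : ℕ} (hN : q < N) :
    evenOdd ρ d s N (2 * q) q = d * s (2 * q) * s q := by
  rw [evenOdd, Finset.sum_eq_single_of_mem q (Finset.mem_range.2 hN)]
  · rw [sub_self (2 * q : ℤ), bin_zero_right, bin_of_neg (k := 2 * q - 1 - 2 * q) (by omega)]
    simp
  · intro i _ hi
    rcases lt_or_gt_of_ne hi with hi | hi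
    · rw [bin_of_lt (by omega) (by omega), bin_of_lt (by omega) (by omega)]; simp
    · rw [bin_of_neg (by omega), bin_of_neg (by omega)]; simp

lemma evenOdd_boundary_succ {N q : ℕ} (hN : q < N) :
    evenOdd ρ d s N (2 * q + 1) q =
      s (2 * q + 1) * d * s q + ρ * d * s (2 * q) * d * s q := by
  rw [evenOdd, Finset.sum_eq_single_of_mem q (Finset.mem_range.2 hN)]
  · rw [bin_of_lt (k := 2 * q + 1 - 2 * q) (by omega) (by omega),
      show (2 * q + 1 - 1 - 2 * q : ℤ) = 0 by ring, bin_zero_right,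
      show (2 * q + 1 + q - q : ℤ) = 2 * q + 1 by ring,
      show (2 * q + 1 + q - 1 - q : ℤ) = 2 * q by ring]
    simp
  · intro i _ hi
    rcases lt_or_gt_of_ne hi with hi | hi
    · rw [bin_of_lt (by omega) (by omega), bin_of_lt (by omega) (by omega)]; simp
    · rw [bin_of_neg (by omega), bin_of_neg (by omega)]; simp

lemma bin_neg_one_one : bin (-1) 1 = 1 := by
  have h := bin_pascal (-1) 1
  rw [neg_add_cancel, bin_of_lt le_rfl one_pos, sub_self, bin_zero_right] at h
  generalize bin (-1) 1 = x at h ⊢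
  revert x; decide

lemma evenOdd_boundary_succ_succ {N q : ℕ} (hN : q + 1 < N) :
    evenOdd ρ d s N (2 * q + 2) q =
      s (2 * q + 2) * d * s q + ρ * d * s (2 * q + 1) * d * s q +
        d * s (2 * q + 1) * s (q + 1) := by
  rw [evenOdd, Finset.sum_eq_add_of_mem q (q + 1) (Finset.mem_range.2 (by omega))
    (Finset.mem_range.2 hN) (by omega)]
  · rw [bin_of_lt (k := 2 * q + 2 - 2 * q) (by omega) (by omega),
      bin_of_neg (k := 2 * q + 2 - 1 - 2 * (q + 1 : ℕ)) (by push_cast; omega)]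
    push_cast
    rw [show (2 * q + 2 - 2 * (q + 1) : ℤ) = 0 by ring, bin_zero_right,
      show (q - 1 - q : ℤ) = -1 by ring, show (2 * q + 2 - 1 - 2 * q : ℤ) = 1 by ring,
      bin_neg_one_one,
      show (2 * q + 2 + q - q : ℤ) = 2 * q + 2 by ring,
      show (2 * q + 2 + q - 1 - q : ℤ) = 2 * q + 1 by ring,
      show (2 * q + 2 + q - (q + 1) : ℤ) = 2 * q + 1 by ring]
    simp
  · rintro i _ ⟨h1, h2⟩
    rcases lt_or_gt_of_ne h1 with hi | hi
    · rw [bin_of_lt (by omega) (by omega), bin_of_lt (by omega) (by omega)]; simp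
    · rw [bin_of_neg (by omega), bin_of_neg (by omega)]; simp

end

section

variable {E : Type*} [AddCommGroup E] [Module (ZMod 2) E] {τ ρ d : Module.End (ZMod 2) E}
  {s : ℤ → Module.End (ZMod 2) E}

variable (τ ρ d s) in
/-- The vectors on which all the Adem relations for `Sq^{2p} Sq^{2q}` and `Sq^{2p} Sq^{2q+1}`
hold. -/
structure AdemAt (x : E) : Prop where
  evenEven {N : ℕ} {p q : ℤ} (hN : p < N) (hpq : p < 2 * q) :
    (s p * s q - evenEven τ d s N p q) x = 0
  evenOdd {N : ℕ} {p q : ℤ} (hN : p < N) (hpq : p ≤ 2 * q) :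
    (s p * d * s q - evenOdd ρ d s N p q) x = 0

namespace CartanRelations

/-- For `p ≤ 0` the relations hold trivially. -/
lemma ademAt_of_pos (h : CartanRelations τ ρ d s) {x : E}
    (h1 : ∀ (N : ℕ) (p q : ℤ), 0 < p → p < N → p < 2 * q →
      (s p * s q - evenEven τ d s N p q) x = 0)
    (h2 : ∀ (N : ℕ) (p q : ℤ), 0 < p → p < N → p ≤ 2 * q →
      (s p * d * s q - evenOdd ρ d s N p q) x = 0) : AdemAt τ ρ d s x where
  evenEven {N p q} hN hpq := by
    rcases lt_trichotomy p 0 with hp | rfl | hp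
    · rw [evenEven_of_neg hp, h.s_neg p hp]; simp
    · rw [evenEven_zero (by omega), h.s_zero]; simp
    · exact h1 N p q hp hN hpq
  evenOdd {N p q} hN hpq := by
    rcases lt_trichotomy p 0 with hp | rfl | hp
    · rw [evenOdd_of_neg hp, h.s_neg p hp]; simp
    · rw [evenOdd_zero (by omega), h.s_zero]; simp
    · exact h2 N p q hp hN hpq

/-- The Adem relations propagate along multiplication by `τ`. -/
lemma ademAt_tau (h : CartanRelations τ ρ d s) {x : E} (hx : AdemAt τ ρ d s x) :
    AdemAt τ ρ d s (τ x) := by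
  -- the relations one and two steps outside the admissible range, consequences of those inside
  have succ {N q : ℕ} (hN : 2 * q + 1 < N) :
      (s (2 * q + 1) * d * s q - RMotivic.evenOdd ρ d s N (2 * q + 1) q) x = 0 := by
    have h1 := congrArg (ρ * d) (hx.evenOdd (N := N) (p := 2 * q) (q := q) (by omega) le_rfl)
    rw [evenOdd_boundary (by omega), map_zero, ← Module.End.mul_apply] at h1
    rw [evenOdd_boundary_succ (by omega)]
    simp only [mul_sub, mul_assoc, h.d_d_mul, mul_zero, sub_zero] at h1 ⊢
    simpa using h1
  have succ_succ {N q : ℕ} (hN : 2 * q + 2 < N) :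
      (s (2 * q + 2) * d * s q - RMotivic.evenOdd ρ d s N (2 * q + 2) q) x = 0 := by
    have h1 := congrArg d (hx.evenEven (N := N) (p := 2 * q + 1) (q := q + 1) (by omega)
      (by omega))
    rw [evenEven_boundary_pred (by omega), map_zero, ← Module.End.mul_apply] at h1
    rw [evenOdd_boundary_succ_succ (by omega)]
    simp only [mul_sub, mul_assoc, h.d_tau_mul, h.d_d_mul, mul_zero, zero_add] at h1 ⊢
    rw [← h1]
    simp only [LinearMap.add_apply, ZModModule.sub_eq_add]
    rw [add_assoc, ← add_assoc, ZModModule.add_self, zero_add, add_comm]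
  refine h.ademAt_of_pos ?_ ?_
  · intro N p q hp hN hpq
    rw [← Module.End.mul_apply, h.evenEven_tau hN]
    have e2 : (s p * d * s (q - 1) - RMotivic.evenOdd ρ d s N p (q - 1)) x = 0 := by
      rcases lt_or_ge (2 * (q - 1)) p with hp' | hp'
      · obtain ⟨r, hr⟩ : ∃ r : ℕ, q - 1 = r := ⟨(q - 1).toNat, by omega⟩
        rw [hr]
        obtain rfl : p = 2 * r + 1 := by omega
        exact succ (by omega)
      · exact hx.evenOdd hN hp'
    simp only [LinearMap.add_apply, Module.End.mul_apply (M := E), e2,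
      hx.evenEven hN hpq, hx.evenEven (N := N) (p := p - 1) (q := q) (by omega) (by omega),
      hx.evenOdd (N := N) (p := p - 1) (q := q - 1) (by omega) (by omega), map_zero, add_zero]
  · intro N p q hp hN hpq
    rw [← Module.End.mul_apply, h.evenOdd_tau hN]
    have e2 : (s p * s q - RMotivic.evenEven τ d s N p q) x = 0 := by
      rcases hpq.lt_or_eq with hp' | rfl
      · exact hx.evenEven hN hp'
      · lift q to ℕ using (by omega)
        rw [evenEven_boundary (by omega), sub_self, LinearMap.zero_apply]
    have e3 : (s p * d * s (q - 1) - RMotivic.evenOdd ρ d s N p (q - 1)) x = 0 := by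
      rcases lt_or_ge (2 * (q - 1)) p with hp' | hp'
      · obtain ⟨r, hr⟩ : ∃ r : ℕ, q - 1 = r := ⟨(q - 1).toNat, by omega⟩
        rw [hr]
        obtain rfl | rfl : p = 2 * r + 1 ∨ p = 2 * r + 2 := by omega
        · exact succ (by omega)
        · exact succ_succ (by omega)
      · exact hx.evenOdd hN hp'
    simp only [LinearMap.add_apply, Module.End.mul_apply (M := E), e2, e3,
      hx.evenOdd hN hpq, hx.evenOdd (N := N) (p := p - 1) (q := q) (by omega) (by omega),
      map_zero, add_zero]

end CartanRelations
end
/-! ### The relations of `𝒜^ℝ` in terms of `Sq^1` and the even squares -/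

lemma choose_even_even (m k : ℕ) : ((2 * m).choose (2 * k) : ZMod 2) = m.choose k := by
  have h := Choose.choose_modEq_choose_mod_mul_choose_div_nat (n := 2 * m) (k := 2 * k) (p := 2)
  simp only [Nat.mul_mod_right, Nat.choose_self, one_mul, ne_eq, OfNat.ofNat_ne_zero,
    not_false_eq_true, mul_div_cancel_left₀] at h
  exact (ZMod.natCast_eq_natCast_iff _ _ _).2 h

lemma choose_odd_even (m k : ℕ) : ((2 * m + 1).choose (2 * k) : ZMod 2) = m.choose k := by
  have h := Choose.choose_modEq_choose_mod_mul_choose_div_nat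
    (n := 2 * m + 1) (k := 2 * k) (p := 2)
  rw [show (2 * m + 1) % 2 = 1 by omega, show (2 * m + 1) / 2 = m by omega,
    show (2 * k) % 2 = 0 by omega, show 2 * k / 2 = k by omega, Nat.choose_zero_right, one_mul] at h
  exact (ZMod.natCast_eq_natCast_iff _ _ _).2 h

lemma choose_even_odd (m k : ℕ) : ((2 * m).choose (2 * k + 1) : ZMod 2) = 0 := by
  have h := Choose.choose_modEq_choose_mod_mul_choose_div_nat
    (n := 2 * m) (k := 2 * k + 1) (p := 2)
  rw [show (2 * m) % 2 = 0 by omega, show (2 * k + 1) % 2 = 1 by omega,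
    Nat.choose_zero_succ, zero_mul] at h
  simpa using (ZMod.natCast_eq_natCast_iff _ _ _).2 h

lemma choose_odd_odd (m k : ℕ) : ((2 * m + 1).choose (2 * k + 1) : ZMod 2) = m.choose k := by
  have h := Choose.choose_modEq_choose_mod_mul_choose_div_nat
    (n := 2 * m + 1) (k := 2 * k + 1) (p := 2)
  rw [show (2 * m + 1) % 2 = 1 by omega, show (2 * m + 1) / 2 = m by omega,
    show (2 * k + 1) % 2 = 1 by omega, show (2 * k + 1) / 2 = k by omega, Nat.choose_self,
    one_mul] at h
  exact (ZMod.natCast_eq_natCast_iff _ _ _).2 h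

lemma sum_range_split {A : Type*} [AddCommMonoid A] (F : ℕ → A) {M N : ℕ} (hM : M ≤ 2 * N) :
    ∑ j ∈ Finset.range M, F j =
      ∑ i ∈ Finset.range N,
        ((if 2 * i < M then F (2 * i) else 0) + if 2 * i + 1 < M then F (2 * i + 1) else 0) := by
  have h (G : ℕ → A) (n : ℕ) : ∑ j ∈ Finset.range (2 * n), G j =
      ∑ i ∈ Finset.range n, (G (2 * i) + G (2 * i + 1)) := by
    induction n with
    | zero => simp
    | succ n ih =>
      rw [mul_add, mul_one, Finset.sum_range_succ, Finset.sum_range_succ, ih,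
        Finset.sum_range_succ, add_assoc]
  rw [← h (fun j => if j < M then F j else 0) N, ← Finset.sum_filter]
  congr 1
  ext j
  simp only [Finset.mem_range, Finset.mem_filter]
  omega

section

variable {R : Type*} [Ring R] [Algebra (ZMod 2) R] {τ ρ d : R} {s : ℤ → R}

variable (τ ρ d s) in
/-- The values of the generators of `𝒜^ℝ` prescribed by `Sq^{2k} = s k` and
`Sq^{2k+1} = d (s k)`. -/
def genValue : Gen → R
  | .tau => τ
  | .rho => ρ
  | .sq n => if Even n then s (n / 2 : ℕ) else d * s (n / 2 : ℕ)

variable (τ ρ d s) in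
/-- The extension of `genValue` to the free algebra. -/
noncomputable def wordValue : Words →ₐ[ZMod 2] R := FreeAlgebra.lift (ZMod 2) (genValue τ ρ d s)

@[simp] lemma wordValue_tau : wordValue τ ρ d s wTau = τ := FreeAlgebra.lift_ι_apply _ _

@[simp] lemma wordValue_rho : wordValue τ ρ d s wRho = ρ := FreeAlgebra.lift_ι_apply _ _

lemma wordValue_sq_even (k : ℕ) : wordValue τ ρ d s (wSq (2 * k)) = s k := by
  simp [wordValue, genValue]

lemma wordValue_sq_odd (k : ℕ) : wordValue τ ρ d s (wSq (2 * k + 1)) = d * s k := by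
  simp [wordValue, genValue, show (2 * k + 1) / 2 = k by omega]

lemma wordValue_sq_even' {n : ℕ} {k : ℤ} (h : (n : ℤ) = 2 * k) :
    wordValue τ ρ d s (wSq n) = s k := by
  lift k to ℕ using by omega
  obtain rfl : n = 2 * k := by omega
  exact wordValue_sq_even k

lemma wordValue_sq_odd' {n : ℕ} {k : ℤ} (h : (n : ℤ) = 2 * k + 1) :
    wordValue τ ρ d s (wSq n) = d * s k := by
  lift k to ℕ using by omega
  obtain rfl : n = 2 * k + 1 := by omega
  exact wordValue_sq_odd k

lemma wordValue_adem_even_even {p q : ℕ} (hpq : p < 2 * q) :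
    wordValue τ ρ d s (ademRHS (2 * p) (2 * q)) = evenEven τ d s (p + 1) p q := by
  have e1 : Even (2 * p) := even_two_mul p
  have e2 : Even (2 * q) := even_two_mul q
  rw [ademRHS, if_pos e1, if_pos e2, show 2 * p / 2 + 1 = p + 1 by omega,
    sum_range_split (N := p + 1) _ (by omega), map_sum, evenEven]
  refine Finset.sum_congr rfl fun i _ => ?_
  rw [map_add]
  congr 1
  · split_ifs with hi
    · rw [map_nsmul, ← Nat.cast_smul_eq_nsmul (ZMod 2), map_mul, map_mul,
        show 2 * q - 1 - 2 * i = 2 * (q - 1 - i) + 1 by omega,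
        show 2 * p - 2 * (2 * i) = 2 * (p - 2 * i) by omega, choose_odd_even,
        show (q - 1 - i : ℤ) = (q - 1 - i : ℕ) by omega,
        show (p - 2 * i : ℤ) = (p - 2 * i : ℕ) by omega, bin_natCast, Nat.mul_mod_right,
        wordValue_sq_even, wordValue_sq_even' (k := p + q - i) (by omega)]
      simp
    · rw [bin_of_neg (by omega)]; simp
  · split_ifs with hi
    · rw [map_nsmul, ← Nat.cast_smul_eq_nsmul (ZMod 2), map_mul, map_mul,
        show 2 * q - 1 - (2 * i + 1) = 2 * (q - 1 - i) by omega,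
        show 2 * p - 2 * (2 * i + 1) = 2 * (p - 1 - 2 * i) by omega, choose_even_even,
        show (q - 1 - i : ℤ) = (q - 1 - i : ℕ) by omega,
        show (p - 1 - 2 * i : ℤ) = (p - 1 - 2 * i : ℕ) by omega, bin_natCast,
        show (2 * i + 1) % 2 = 1 by omega, pow_one,
        wordValue_sq_odd, wordValue_sq_odd' (k := p + q - 1 - i) (by omega), wordValue_tau]
      simp only [mul_assoc]
    · rw [bin_of_neg (by omega)]; simp

lemma wordValue_adem_even_odd {p q : ℕ} (hpq : p ≤ 2 * q) :
    wordValue τ ρ d s (ademRHS (2 * p) (2 * q + 1)) = evenOdd ρ d s (p + 1) p q := by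
  have e1 : Even (2 * p) := even_two_mul p
  have e2 : ¬ Even (2 * q + 1) := Nat.not_even_bit1 q
  rw [ademRHS, if_pos e1, if_neg e2, show 2 * p / 2 + 1 = p + 1 by omega,
    sum_range_split (N := p + 1) _ (by omega), map_sum, evenOdd]
  refine Finset.sum_congr rfl fun i _ => ?_
  rw [map_add]
  congr 1
  · split_ifs with hi
    · rw [map_add, map_nsmul, map_nsmul, ← Nat.cast_smul_eq_nsmul (ZMod 2),
        ← Nat.cast_smul_eq_nsmul (ZMod 2), map_mul,
        show 2 * q + 1 - 1 - 2 * i = 2 * (q - i) by omega,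
        show 2 * p - 2 * (2 * i) = 2 * (p - 2 * i) by omega, choose_even_even,
        show 2 * p + 1 - 2 * (2 * i) = 2 * (p - 2 * i) + 1 by omega, choose_even_odd,
        show (q - i : ℤ) = (q - i : ℕ) by omega,
        show (p - 2 * i : ℤ) = (p - 2 * i : ℕ) by omega, bin_natCast,
        wordValue_sq_even, wordValue_sq_odd' (k := p + q - i) (by omega)]
      simp
    · rw [bin_of_neg (by omega)]; simp
  · split_ifs with hi
    · rw [map_add, map_nsmul, map_nsmul, ← Nat.cast_smul_eq_nsmul (ZMod 2),
        ← Nat.cast_smul_eq_nsmul (ZMod 2), map_mul, map_mul, map_mul,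
        show 2 * q + 1 - 1 - (2 * i + 1) = 2 * (q - 1 - i) + 1 by omega,
        show 2 * p - 2 * (2 * i + 1) = 2 * (p - 1 - 2 * i) by omega, choose_odd_even,
        show 2 * p + 1 - 2 * (2 * i + 1) = 2 * (p - 1 - 2 * i) + 1 by omega, choose_odd_odd,
        show (q - 1 - i : ℤ) = (q - 1 - i : ℕ) by omega,
        show (p - 1 - 2 * i : ℤ) = (p - 1 - 2 * i : ℕ) by omega, bin_natCast,
        wordValue_sq_odd, wordValue_sq_even' (k := p + q - i) (by omega),
        wordValue_sq_odd' (k := p + q - 1 - i) (by omega), wordValue_rho, smul_add]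
      simp only [mul_assoc]
    · rw [bin_of_neg (by omega)]; simp

lemma CartanRelations.wordValue_adem_odd_even (h : CartanRelations τ ρ d s) {p q : ℕ}
    (hpq : p < 2 * q) :
    wordValue τ ρ d s (ademRHS (2 * p + 1) (2 * q)) = d * evenEven τ d s (p + 1) p q := by
  have e1 : ¬ Even (2 * p + 1) := Nat.not_even_bit1 p
  have e2 : Even (2 * q) := even_two_mul q
  rw [ademRHS, if_neg e1, if_pos e2, show (2 * p + 1 - 1) / 2 + 1 = p + 1 by omega,
    sum_range_split (N := p + 1) _ (by omega), map_sum, evenEven, Finset.mul_sum]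
  refine Finset.sum_congr rfl fun i _ => ?_
  rw [map_add, mul_add d]
  congr 1
  · split_ifs with hi
    · rw [map_add, map_nsmul, map_nsmul, ← Nat.cast_smul_eq_nsmul (ZMod 2),
        ← Nat.cast_smul_eq_nsmul (ZMod 2), map_mul,
        show 2 * q - 1 - 2 * i = 2 * (q - 1 - i) + 1 by omega,
        show 2 * q - 2 * i = 2 * (q - i) by omega,
        show 2 * p + 1 - 2 * (2 * i) = 2 * (p - 2 * i) + 1 by omega, choose_odd_odd,
        choose_even_odd,
        show (q - 1 - i : ℤ) = (q - 1 - i : ℕ) by omega,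
        show (p - 2 * i : ℤ) = (p - 2 * i : ℕ) by omega, bin_natCast,
        wordValue_sq_even, wordValue_sq_odd' (k := p + q - i) (by omega)]
      simp [mul_assoc]
    · rw [bin_of_neg (by omega)]; simp
  · split_ifs with hi
    · rw [map_add, map_nsmul, map_nsmul, ← Nat.cast_smul_eq_nsmul (ZMod 2),
        ← Nat.cast_smul_eq_nsmul (ZMod 2), map_mul, map_mul, map_mul,
        show 2 * q - 1 - (2 * i + 1) = 2 * (q - 1 - i) by omega,
        show 2 * q - (2 * i + 1) = 2 * (q - 1 - i) + 1 by omega,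
        show 2 * p + 1 - 2 * (2 * i + 1) = 2 * (p - 1 - 2 * i) + 1 by omega, choose_odd_odd,
        choose_even_odd,
        show (q - 1 - i : ℤ) = (q - 1 - i : ℕ) by omega,
        show (p - 1 - 2 * i : ℤ) = (p - 1 - 2 * i : ℕ) by omega, bin_natCast,
        wordValue_sq_odd, wordValue_sq_odd' (n := _ - 1) (k := p + q - 1 - i) (by omega),
        wordValue_rho]
      simp only [mul_assoc, mul_smul_comm, h.d_tau_mul, h.d_d_mul, mul_zero, zero_add, zero_smul]
    · rw [bin_of_neg (by omega)]; simp

lemma CartanRelations.wordValue_adem_odd_odd (h : CartanRelations τ ρ d s) {p q : ℕ}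
    (hpq : p ≤ 2 * q) :
    wordValue τ ρ d s (ademRHS (2 * p + 1) (2 * q + 1)) = d * evenOdd ρ d s (p + 1) p q := by
  have e1 : ¬ Even (2 * p + 1) := Nat.not_even_bit1 p
  have e2 : ¬ Even (2 * q + 1) := Nat.not_even_bit1 q
  rw [ademRHS, if_neg e1, if_neg e2, show (2 * p + 1 - 1) / 2 + 1 = p + 1 by omega,
    sum_range_split (N := p + 1) _ (by omega), map_sum, evenOdd, Finset.mul_sum]
  refine Finset.sum_congr rfl fun i _ => ?_
  rw [map_add, mul_add d]
  congr 1
  · split_ifs with hi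
    · rw [map_nsmul, ← Nat.cast_smul_eq_nsmul (ZMod 2),
        show 2 * q + 1 - 1 - 2 * i = 2 * (q - i) by omega,
        show 2 * p + 1 - 2 * (2 * i) = 2 * (p - 2 * i) + 1 by omega, choose_even_odd]
      simp [mul_assoc, h.d_d_mul]
    · simp [mul_assoc, h.d_d_mul]
  · split_ifs with hi
    · rw [map_nsmul, ← Nat.cast_smul_eq_nsmul (ZMod 2), map_mul,
        show 2 * q + 1 - 1 - (2 * i + 1) = 2 * (q - 1 - i) + 1 by omega,
        show 2 * p + 1 - 2 * (2 * i + 1) = 2 * (p - 1 - 2 * i) + 1 by omega, choose_odd_odd,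
        show (q - 1 - i : ℤ) = (q - 1 - i : ℕ) by omega,
        show (p - 1 - 2 * i : ℤ) = (p - 1 - 2 * i : ℕ) by omega, bin_natCast,
        wordValue_sq_odd, wordValue_sq_odd' (k := p + q - i) (by omega)]
      simp only [mul_assoc, mul_smul_comm, mul_add, h.d_rho_mul, h.d_d_mul, mul_zero, add_zero]
    · rw [bin_of_neg (by omega)]; simp

/-- The relations of `𝒜^ℝ` follow from the Cartan relations and the two families of Adem
relations for `Sq^{2p} Sq^{2q}` and `Sq^{2p} Sq^{2q+1}`. -/
lemma CartanRelations.wordValue_eq (h : CartanRelations τ ρ d s)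
    (hee : ∀ p q : ℕ, p < 2 * q → s p * s q = evenEven τ d s (p + 1) p q)
    (heo : ∀ p q : ℕ, p ≤ 2 * q → s p * d * s q = evenOdd ρ d s (p + 1) p q)
    {x y : Words} (hxy : SteenrodRel x y) : wordValue τ ρ d s x = wordValue τ ρ d s y := by
  cases hxy with
  | tau_rho => simp [h.tau_rho]
  | sq_zero => simpa [h.s_zero] using wordValue_sq_even (τ := τ) (ρ := ρ) (d := d) (s := s) 0
  | sq_rho n =>
    obtain ⟨k, rfl | rfl⟩ := n.even_or_odd'
    · simp [wordValue_sq_even, h.s_rho]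
    · simp [wordValue_sq_odd, mul_assoc, h.s_rho, h.d_rho_mul]
  | sq_even_tau n =>
    rw [show 2 * n + 2 = 2 * (n + 1) by ring]
    simp [wordValue_sq_even, wordValue_sq_odd, h.s_tau, mul_assoc]
  | sq_one_tau =>
    have := wordValue_sq_odd (τ := τ) (ρ := ρ) (d := d) (s := s) 0
    simp only [mul_zero, zero_add, Nat.cast_zero, h.s_zero, mul_one] at this
    simp [this, h.d_tau]
  | sq_odd_tau n =>
    rw [show 2 * n + 3 = 2 * (n + 1) + 1 by ring, show 2 * n + 2 = 2 * (n + 1) by ring]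
    simp only [map_mul, map_add, wordValue_sq_even, wordValue_sq_odd, wordValue_tau,
      wordValue_rho, pow_two]
    simp only [mul_assoc, h.s_tau', mul_add, h.d_tau_mul, h.d_rho_mul, h.d_d_mul]
    simp [add_assoc]
  | adem a b ha hab =>
    obtain ⟨p, rfl | rfl⟩ := a.even_or_odd' <;> obtain ⟨q, rfl | rfl⟩ := b.even_or_odd'
    · rw [map_mul, wordValue_sq_even, wordValue_sq_even, hee p q (by omega),
        wordValue_adem_even_even (by omega)]
    · rw [map_mul, wordValue_sq_even, wordValue_sq_odd, ← mul_assoc, heo p q (by omega),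
        wordValue_adem_even_odd (by omega)]
    · rw [map_mul, wordValue_sq_odd, wordValue_sq_even, mul_assoc, hee p q (by omega),
        h.wordValue_adem_odd_even (by omega)]
    · rw [map_mul, wordValue_sq_odd, wordValue_sq_odd, mul_assoc, ← mul_assoc (s p),
        heo p q (by omega), h.wordValue_adem_odd_odd (by omega)]

end
/-! ### Adem relations in low degrees -/

section

variable {R : Type*} [Ring R] [Algebra (ZMod 2) R] {τ ρ d : R} {s : ℤ → R}

lemma evenEven_eq {N M : ℕ} {p q : ℤ} (hN : p < N) (hM : p < M) :
    evenEven τ d s N p q = evenEven τ d s M p q := by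
  wlog h : N ≤ M generalizing N M
  · exact (this hM hN (by omega)).symm
  refine Finset.sum_subset (Finset.range_mono h) fun i _ hi => ?_
  rw [Finset.mem_range] at hi
  rw [bin_of_neg (by omega), bin_of_neg (by omega)]; simp

lemma evenOdd_eq {N M : ℕ} {p q : ℤ} (hN : p < N) (hM : p < M) :
    evenOdd ρ d s N p q = evenOdd ρ d s M p q := by
  wlog h : N ≤ M generalizing N M
  · exact (this hM hN (by omega)).symm
  refine Finset.sum_subset (Finset.range_mono h) fun i _ hi => ?_
  rw [Finset.mem_range] at hi
  rw [bin_of_neg (by omega), bin_of_neg (by omega)]; simp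

lemma bin_one_one : bin 1 1 = 1 := by simpa using bin_natCast 1 1

lemma bin_two_one : bin 2 1 = 0 := (bin_natCast 2 1).trans (by decide)

lemma evenEven_one_one : evenEven τ d s 2 1 1 = τ * d * s 1 * d * s 0 := by
  norm_num [evenEven, Finset.sum_range_succ, bin_of_lt, bin_of_neg, bin_zero_right]

lemma evenEven_one_two :
    evenEven τ d s 2 1 2 = s 3 * s 0 + τ * d * s 2 * d * s 0 := by
  norm_num [evenEven, Finset.sum_range_succ, bin_one_one, bin_of_neg, bin_zero_right]

lemma evenEven_one_three : evenEven τ d s 2 1 3 = τ * d * s 3 * d * s 0 := by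
  norm_num [evenEven, Finset.sum_range_succ, bin_two_one, bin_of_neg, bin_zero_right]

lemma evenEven_two_two :
    evenEven τ d s 3 2 2 = τ * d * s 3 * d * s 0 + s 3 * s 1 := by
  norm_num [evenEven, Finset.sum_range_succ, bin_of_lt, bin_one_one, bin_of_neg, bin_zero_right]

lemma evenOdd_one_one :
    evenOdd ρ d s 2 1 1 = d * s 2 * s 0 + (s 2 * d * s 0 + ρ * d * s 1 * d * s 0) := by
  norm_num [evenOdd, Finset.sum_range_succ, bin_one_one, bin_of_neg, bin_zero_right]

lemma evenOdd_two_one : evenOdd ρ d s 3 2 1 = d * s 2 * s 1 := by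
  norm_num [evenOdd, Finset.sum_range_succ, bin_of_lt, bin_of_neg, bin_zero_right]

lemma evenOdd_one_two :
    evenOdd ρ d s 2 1 2 = s 3 * d * s 0 + ρ * d * s 2 * d * s 0 := by
  norm_num [evenOdd, Finset.sum_range_succ, bin_two_one, bin_of_neg, bin_zero_right]

end

section

variable {E : Type*} [AddCommGroup E] [Module (ZMod 2) E] {τ ρ d : Module.End (ZMod 2) E}
  {s : ℤ → Module.End (ZMod 2) E}

lemma CartanRelations.ademAt_rho (h : CartanRelations τ ρ d s) {x : E} (hx : AdemAt τ ρ d s x) :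
    AdemAt τ ρ d s (ρ x) where
  evenEven {N p q} hN hpq := by
    have key : (s p * s q - RMotivic.evenEven τ d s N p q) * ρ =
        ρ * (s p * s q - RMotivic.evenEven τ d s N p q) := by
      simp only [RMotivic.evenEven, sub_mul, mul_sub, Finset.sum_mul, Finset.mul_sum, add_mul,
        mul_add, smul_mul_assoc, mul_smul_comm, mul_assoc, h.s_rho, h.d_rho_mul, h.s_rho_mul,
        h.tau_rho_mul]
    rw [← Module.End.mul_apply, key, Module.End.mul_apply, hx.evenEven hN hpq, map_zero]
  evenOdd {N p q} hN hpq := by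
    have key : (s p * d * s q - RMotivic.evenOdd ρ d s N p q) * ρ =
        ρ * (s p * d * s q - RMotivic.evenOdd ρ d s N p q) := by
      simp only [RMotivic.evenOdd, sub_mul, mul_sub, Finset.sum_mul, Finset.mul_sum, add_mul,
        mul_add, smul_mul_assoc, mul_smul_comm, mul_assoc, h.s_rho, h.d_rho_mul, h.s_rho_mul]
    rw [← Module.End.mul_apply, key, Module.End.mul_apply, hx.evenOdd hN hpq, map_zero]

end

/-! ### Free modules with prescribed operations -/

/-- The free `𝔽₂[τ, ρ]`-module on eight generators, as the `𝔽₂`-vector space with a basis vector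
for each monomial `τ^k ρ^l` and each generator. -/
abbrev Free8 : Type := ℕ × ℕ × Fin 8 →₀ ZMod 2

namespace Free8

/-- The basis vector `τ^k ρ^l e_i`. -/
noncomputable def mon (k l : ℕ) (i : Fin 8) : Free8 := Finsupp.single (k, l, i) 1

/-- The generator `e_i`. -/
noncomputable def e (i : Fin 8) : Free8 := mon 0 0 i

/-- Multiplication by `τ`. -/
noncomputable def tau : Module.End (ZMod 2) Free8 :=
  Finsupp.linearCombination (ZMod 2) fun p => mon (p.1 + 1) p.2.1 p.2.2

/-- Multiplication by `ρ`. -/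
noncomputable def rho : Module.End (ZMod 2) Free8 :=
  Finsupp.linearCombination (ZMod 2) fun p => mon p.1 (p.2.1 + 1) p.2.2

lemma linearCombination_mon {M : Type*} [AddCommGroup M] [Module (ZMod 2) M]
    (f : ℕ × ℕ × Fin 8 → M) (k l : ℕ) (i : Fin 8) :
    Finsupp.linearCombination (ZMod 2) f (mon k l i) = f (k, l, i) := by
  simp [mon]

@[simp] lemma tau_mon (k l : ℕ) (i : Fin 8) : tau (mon k l i) = mon (k + 1) l i :=
  linearCombination_mon _ _ _ _

@[simp] lemma rho_mon (k l : ℕ) (i : Fin 8) : rho (mon k l i) = mon k (l + 1) i :=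
  linearCombination_mon _ _ _ _

lemma hom_ext {M : Type*} [AddCommGroup M] [Module (ZMod 2) M] {f g : Free8 →ₗ[ZMod 2] M}
    (h : ∀ k l i, f (mon k l i) = g (mon k l i)) : f = g :=
  Finsupp.lhom_ext' fun p => LinearMap.ext_ring (h p.1 p.2.1 p.2.2)

lemma tau_mul_rho : tau * rho = rho * tau := hom_ext fun k l i => by simp

lemma tau_pow_rho_pow (k l : ℕ) (i : Fin 8) : (tau ^ k) ((rho ^ l) (e i)) = mon k l i := by
  have h1 : (rho ^ l) (e i) = mon 0 l i := by
    induction l with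
    | zero => rfl
    | succ l ih => rw [pow_succ', Module.End.mul_apply, ih, rho_mon]
  rw [h1]
  induction k with
  | zero => rfl
  | succ k ih => rw [pow_succ', Module.End.mul_apply, ih, tau_mon]

/-- Two `𝔽₂`-linear maps agree if the set where they agree contains the generators and is stable
under `τ` and `ρ`. -/
lemma hom_ext_of_stable {M : Type*} [AddCommGroup M] [Module (ZMod 2) M]
    {f g : Free8 →ₗ[ZMod 2] M} (he : ∀ i, f (e i) = g (e i))
    (ht : ∀ x, f x = g x → f (tau x) = g (tau x)) (hr : ∀ x, f x = g x → f (rho x) = g (rho x)) :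
    f = g := by
  refine hom_ext fun k l i => ?_
  induction k with
  | zero =>
    induction l with
    | zero => exact he i
    | succ l ih => simpa using hr _ ih
  | succ k ih => simpa using ht _ ih

/-- The values of `Sq^1` on the generators. -/
noncomputable def sq1Value : Fin 8 → Free8 := ![e 1, 0, e 3, 0, e 5, 0, e 7, 0]

/-- The operation `Sq^1`, determined by its values on the generators and the Cartan formula
`Sq^1 (τ^k x) = τ^k Sq^1 x + k τ^{k-1} ρ x`. -/
noncomputable def sq1 : Module.End (ZMod 2) Free8 :=
  Finsupp.linearCombination (ZMod 2) fun p =>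
    (tau ^ p.1) ((rho ^ p.2.1) (sq1Value p.2.2)) + (p.1 : ZMod 2) • mon (p.1 - 1) (p.2.1 + 1) p.2.2

lemma sq1_mon (k l : ℕ) (i : Fin 8) :
    sq1 (mon k l i) =
      (tau ^ k) ((rho ^ l) (sq1Value i)) + (k : ZMod 2) • mon (k - 1) (l + 1) i :=
  linearCombination_mon _ _ _ _

@[simp] lemma sq1_e (i : Fin 8) : sq1 (e i) = sq1Value i := by
  rw [e, sq1_mon]; simp

lemma commute_rho_tau_pow (k : ℕ) (x : Free8) : rho ((tau ^ k) x) = (tau ^ k) (rho x) := by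
  have h : Commute rho tau := tau_mul_rho.symm
  exact LinearMap.congr_fun (h.pow_right k) x

lemma sq1_mul_rho : sq1 * rho = rho * sq1 := hom_ext fun k l i => by
  simp [sq1_mon, pow_succ', commute_rho_tau_pow]

lemma sq1_mul_tau : sq1 * tau = tau * sq1 + rho := hom_ext fun k l i => by
  rcases k with _ | k
  · simp [sq1_mon]
  · simp [sq1_mon, pow_succ', add_smul, add_assoc, two_smul]

lemma sq1_rho (x : Free8) : sq1 (rho x) = rho (sq1 x) := LinearMap.congr_fun sq1_mul_rho x

lemma sq1_tau (x : Free8) : sq1 (tau x) = tau (sq1 x) + rho x := LinearMap.congr_fun sq1_mul_tau x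

lemma sq1_mul_sq1 : sq1 * sq1 = 0 := by
  refine hom_ext_of_stable (fun i => ?_) (fun x hx => ?_) (fun x hx => ?_)
  · fin_cases i <;> simp [sq1Value]
  · simp only [Module.End.mul_apply, LinearMap.zero_apply] at hx ⊢
    rw [sq1_tau, map_add, sq1_tau, hx, sq1_rho, map_zero, zero_add, ZModModule.add_self]
  · simp only [Module.End.mul_apply, LinearMap.zero_apply] at hx ⊢
    rw [sq1_rho, sq1_rho, hx, map_zero]

variable (v : Fin 7 → ZMod 2)

/-- The values of `Sq^{2m}` on the generators, for the parameters
`v = (α₀₃, β₀₃, β₁₄, β₀₆, β₂₅, β₂₆, γ₃₆)`. The values for `m = 3` are forced by the Adem relation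
`Sq^2 Sq^4 = Sq^6 + τ Sq^5 Sq^1`. -/
noncomputable def evenValue (m : ℤ) : Fin 8 → Free8 :=
  if m = 0 then e
  else if m = 1 then ![e 2, e 4, tau (e 5), e 6, 0, e 7, 0, 0]
  else if m = 2 then
    ![v 1 • rho (e 4) + (1 + v 1 + v 2) • tau (e 5) + v 0 • rho (e 3),
      e 6 + v 2 • rho (e 5),
      v 5 • tau (e 7) + v 4 • rho (e 6) + (v 1 * v 6 + v 0 * (v 4 + v 5)) • rho (rho (e 5)),
      (v 4 + v 5) • rho (e 7), v 6 • rho (e 7), 0, 0, 0]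
  else if m = 3 then
    ![(v 1 + v 2) • tau (e 7) + v 0 • rho (e 6), v 2 • rho (e 7),
      (v 1 * v 6 + v 0 * (v 4 + v 5)) • rho (rho (e 7)), 0, 0, 0, 0, 0]
  else if m = 4 then ![v 3 • rho (rho (e 7)), 0, 0, 0, 0, 0, 0, 0]
  else 0

/-- The value of `Sq^{2m}` on `τ^k e_i`, by the Cartan formula
`Sq^{2m} (τ x) = τ (Sq^{2m} x + ρ Sq^1 Sq^{2m-2} x)`. -/
noncomputable def evenTauPow (i : Fin 8) : ℕ → ℤ → Free8
  | 0, m => evenValue v m i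
  | k + 1, m => tau (evenTauPow i k m + rho (sq1 (evenTauPow i k (m - 1))))

/-- The operation `Sq^{2m}`; it is zero for `m < 0`. -/
noncomputable def even (m : ℤ) : Module.End (ZMod 2) Free8 :=
  Finsupp.linearCombination (ZMod 2) fun p => (rho ^ p.2.1) (evenTauPow v p.2.2 p.1 m)

lemma even_mon (m : ℤ) (k l : ℕ) (i : Fin 8) :
    even v m (mon k l i) = (rho ^ l) (evenTauPow v i k m) :=
  linearCombination_mon _ _ _ _

lemma even_e (m : ℤ) (i : Fin 8) : even v m (e i) = evenValue v m i := by
  rw [e, even_mon]; rfl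

lemma evenValue_neg {m : ℤ} (hm : m < 0) (i : Fin 8) : evenValue v m i = 0 := by
  simp [evenValue, show m ≠ 0 by omega, show m ≠ 1 by omega, show m ≠ 2 by omega,
    show m ≠ 3 by omega, show m ≠ 4 by omega]

lemma evenTauPow_neg (i : Fin 8) (k : ℕ) {m : ℤ} (hm : m < 0) : evenTauPow v i k m = 0 := by
  induction k generalizing m with
  | zero => exact evenValue_neg v hm i
  | succ k ih => rw [evenTauPow, ih hm, ih (by omega)]; simp

lemma evenTauPow_zero (i : Fin 8) (k : ℕ) : evenTauPow v i k 0 = mon k 0 i := by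
  induction k with
  | zero => simp [evenTauPow, evenValue, e]
  | succ k ih => rw [evenTauPow, ih, evenTauPow_neg v i k (by omega)]; simp

lemma commute_sq1_rho_pow (l : ℕ) (x : Free8) : sq1 ((rho ^ l) x) = (rho ^ l) (sq1 x) := by
  have h : Commute sq1 rho := sq1_mul_rho
  exact LinearMap.congr_fun (h.pow_right l) x

lemma commute_tau_rho_pow (l : ℕ) (x : Free8) : tau ((rho ^ l) x) = (rho ^ l) (tau x) := by
  have h : Commute tau rho := tau_mul_rho
  exact LinearMap.congr_fun (h.pow_right l) x

lemma commute_rho_rho_pow (l : ℕ) (x : Free8) : rho ((rho ^ l) x) = (rho ^ l) (rho x) :=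
  LinearMap.congr_fun ((Commute.refl rho).pow_right l) x

lemma cartanRelations : CartanRelations tau rho sq1 (even v) where
  tau_rho := tau_mul_rho
  d_rho := sq1_mul_rho
  s_rho m := hom_ext fun k l i => by simp [even_mon, pow_succ']
  d_tau := sq1_mul_tau
  d_d := sq1_mul_sq1
  s_tau m := hom_ext fun k l i => by
    simp [even_mon, evenTauPow, commute_sq1_rho_pow, commute_rho_rho_pow, commute_tau_rho_pow]
  s_neg m hm := hom_ext fun k l i => by simp [even_mon, evenTauPow_neg v i k hm]
  s_zero := hom_ext fun k l i => by
    rw [even_mon, evenTauPow_zero]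
    induction l with
    | zero => rfl
    | succ l ih => rw [pow_succ', Module.End.mul_apply, ih]; simp

lemma even_tau (m : ℤ) (x : Free8) :
    even v m (tau x) = tau (even v m x) + tau (rho (sq1 (even v (m - 1) x))) :=
  LinearMap.congr_fun ((cartanRelations v).s_tau m) x

lemma even_rho (m : ℤ) (x : Free8) : even v m (rho x) = rho (even v m x) :=
  LinearMap.congr_fun ((cartanRelations v).s_rho m) x

end Free8
namespace Free8

/-! ### Bidegrees and the Adem relations in the models -/

/-- The topological degrees of the eight generators. -/
def topDegree : Fin 8 → ℤ := ![0, 1, 2, 3, 3, 4, 5, 6]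

/-- The weights of the eight generators. -/
def weight : Fin 8 → ℤ := ![0, 0, 1, 1, 1, 1, 2, 2]

/-- The bidegree of `τ^k ρ^l e_i`. -/
def degree (p : ℕ × ℕ × Fin 8) : ℤ × ℤ :=
  (p.2.1 + topDegree p.2.2, p.1 + p.2.1 + weight p.2.2)

/-- The homogeneous elements of bidegree `d`. -/
noncomputable def homogeneous (d : ℤ × ℤ) : Submodule (ZMod 2) Free8 :=
  Finsupp.supported (ZMod 2) (ZMod 2) {p | degree p = d}

lemma mon_mem {d : ℤ × ℤ} {k l : ℕ} {i : Fin 8} (h : degree (k, l, i) = d) :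
    mon k l i ∈ homogeneous d :=
  Finsupp.single_mem_supported _ _ h

/-- The linear map `f` raises bidegrees by `e`. -/
def Raises (f : Module.End (ZMod 2) Free8) (e : ℤ × ℤ) : Prop :=
  ∀ (d : ℤ × ℤ) (x : Free8), x ∈ homogeneous d → f x ∈ homogeneous (d + e)

lemma raises_of_mon {f : Module.End (ZMod 2) Free8} {a : ℤ × ℤ}
    (h : ∀ k l i, f (mon k l i) ∈ homogeneous (degree (k, l, i) + a)) : Raises f a := by
  intro d x hx
  rw [homogeneous, Finsupp.supported_eq_span_single] at hx
  induction hx using Submodule.span_induction with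
  | mem y hy => obtain ⟨p, rfl, rfl⟩ := hy; exact h p.1 p.2.1 p.2.2
  | zero => rw [map_zero]; exact zero_mem _
  | add y z _ _ hy hz => rw [map_add]; exact add_mem hy hz
  | smul c y _ hy => rw [map_smul]; exact Submodule.smul_mem _ _ hy

namespace Raises

variable {f g : Module.End (ZMod 2) Free8} {a b c : ℤ × ℤ}

lemma add (hf : Raises f a) (hg : Raises g a) : Raises (f + g) a :=
  fun d x hx => add_mem (hf d x hx) (hg d x hx)

lemma sub (hf : Raises f a) (hg : Raises g a) : Raises (f - g) a :=
  fun d x hx => sub_mem (hf d x hx) (hg d x hx)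

lemma smul (r : ZMod 2) (hf : Raises f a) : Raises (r • f) a :=
  fun d x hx => Submodule.smul_mem _ r (hf d x hx)

lemma mul (hf : Raises f a) (hg : Raises g b) : Raises (f * g) (a + b) := fun d x hx => by
  rw [add_comm a, ← add_assoc]
  exact hf _ _ (hg d x hx)

lemma sum {ι : Type*} {s : Finset ι} {f : ι → Module.End (ZMod 2) Free8}
    (h : ∀ i ∈ s, Raises (f i) a) : Raises (∑ i ∈ s, f i) a := fun d x hx => by
  rw [LinearMap.sum_apply]
  exact sum_mem fun i hi => h i hi d x hx

lemma pow (hf : Raises f a) (n : ℕ) : Raises (f ^ n) (n • a) := by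
  induction n with
  | zero => intro d x hx; simpa using hx
  | succ n ih => rw [pow_succ, succ_nsmul]; exact ih.mul hf

lemma congr (hf : Raises f a) (h : a = b) : Raises f b := h ▸ hf

end Raises

lemma raises_tau : Raises tau (0, 1) := raises_of_mon fun k l i => by
  rw [tau_mon]
  exact mon_mem (by (ext <;> simp [degree]) ; ring)

lemma raises_rho : Raises rho (1, 1) := raises_of_mon fun k l i => by
  rw [rho_mon]
  exact mon_mem (by (ext <;> simp [degree]) <;> ring)

lemma sq1Value_mem (i : Fin 8) : sq1Value i ∈ homogeneous (degree (0, 0, i) + (1, 0)) := by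
  fin_cases i <;> first | exact mon_mem (by decide) | exact zero_mem _

lemma raises_sq1 : Raises sq1 (1, 0) := raises_of_mon fun k l i => by
  rw [sq1_mon]
  refine add_mem ?_ ?_
  · have h := (raises_tau.pow k) _ _ ((raises_rho.pow l) _ _ (sq1Value_mem i))
    convert h using 2
    (ext <;> simp [degree]) <;> ring
  · rcases k with _ | k
    · simp
    · refine Submodule.smul_mem _ _ (mon_mem ?_)
      (ext <;> simp [degree]) <;> ring

variable (v : Fin 7 → ZMod 2)

lemma evenValue_mem (m : ℤ) (i : Fin 8) :
    evenValue v m i ∈ homogeneous (degree (0, 0, i) + (2 * m, m)) := by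
  unfold evenValue
  split_ifs with h0 h1 h2 h3 h4
  · subst h0
    exact mon_mem (by simp)
  · subst h1
    fin_cases i <;> simp [e] <;> exact mon_mem (by decide)
  · subst h2
    fin_cases i <;> simp [e] <;>
      repeat' first
        | exact zero_mem _ | apply Submodule.add_mem | apply Submodule.smul_mem
        | exact mon_mem (by decide)
  · subst h3
    fin_cases i <;> simp [e] <;>
      repeat' first
        | exact zero_mem _ | apply Submodule.add_mem | apply Submodule.smul_mem
        | exact mon_mem (by decide)
  · subst h4
    fin_cases i <;> simp [e] <;>
      repeat' first
        | exact zero_mem _ | apply Submodule.add_mem | apply Submodule.smul_mem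
        | exact mon_mem (by decide)
  · exact zero_mem _

lemma evenTauPow_mem (i : Fin 8) (k : ℕ) (m : ℤ) :
    evenTauPow v i k m ∈ homogeneous (degree (k, 0, i) + (2 * m, m)) := by
  induction k generalizing m with
  | zero => exact evenValue_mem v m i
  | succ k ih =>
    rw [evenTauPow, map_add]
    refine add_mem ?_ ?_
    · convert raises_tau _ _ (ih m) using 2
      ext <;> simp [degree]; ring
    · convert raises_tau _ _ (raises_rho _ _ (raises_sq1 _ _ (ih (m - 1)))) using 2
      (ext <;> simp [degree]) <;> ring

lemma raises_even (m : ℤ) : Raises (even v m) (2 * m, m) := raises_of_mon fun k l i => by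
  rw [even_mon]
  convert (raises_rho.pow l) _ _ (evenTauPow_mem v i k m) using 2
  (ext <;> simp [degree]) <;> ring

lemma raises_evenEven (N : ℕ) (p q : ℤ) :
    Raises (even v p * even v q - evenEven tau sq1 (even v) N p q) (2 * (p + q), p + q) := by
  refine (((raises_even v p).mul (raises_even v q)).congr (by ext <;> simp; ring)).sub
    (.sum fun i _ => .add (.smul _ ?_) (.smul _ ?_))
  · exact ((raises_even v _).mul (raises_even v _)).congr (by ext <;> simp; ring)
  · exact ((((raises_tau.mul raises_sq1).mul (raises_even v _)).mul raises_sq1).mul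
      (raises_even v _)).congr (by ext <;> simp <;> ring)

lemma raises_evenOdd (N : ℕ) (p q : ℤ) :
    Raises (even v p * sq1 * even v q - evenOdd rho sq1 (even v) N p q)
      (2 * (p + q) + 1, p + q) := by
  refine ((((raises_even v p).mul raises_sq1).mul (raises_even v q)).congr
    (by ext <;> simp; ring)).sub (.sum fun i _ => .add (.smul _ ?_) (.smul _ (.add ?_ ?_)))
  · exact ((raises_sq1.mul (raises_even v _)).mul (raises_even v _)).congr
      (by ext <;> simp; ring)
  · exact (((raises_even v _).mul raises_sq1).mul (raises_even v _)).congr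
      (by ext <;> simp; ring)
  · exact ((((raises_rho.mul raises_sq1).mul (raises_even v _)).mul raises_sq1).mul
      (raises_even v _)).congr (by ext <;> simp <;> ring)

lemma coweight_bounds (i : Fin 8) : 0 ≤ topDegree i - weight i ∧ topDegree i - weight i ≤ 4 := by
  revert i; decide

/-- The difference of topological degree and weight is at most `4` on nonzero elements. -/
lemma eq_zero_of_mem {d : ℤ × ℤ} (hd : 4 < d.1 - d.2) {x : Free8} (hx : x ∈ homogeneous d) :
    x = 0 := by
  have h : {p | degree p = d} = ∅ := by
    refine Set.eq_empty_of_forall_notMem fun p hp => ?_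
    obtain ⟨k, l, i⟩ := p
    obtain rfl : degree (k, l, i) = d := hp
    have := coweight_bounds i
    simp only [degree] at hd
    omega
  rw [homogeneous, h, Finsupp.supported_empty] at hx
  exact hx

/-- The Adem relations hold on the generators: those which do not vanish for degree reasons are
checked directly. -/
lemma ademAt_e (i : Fin 8) : AdemAt tau rho sq1 (even v) (e i) := by
  refine (cartanRelations v).ademAt_of_pos ?_ ?_
  · intro N p q hp hN hpq
    by_cases hd : 4 < topDegree i - weight i + (p + q)
    · refine eq_zero_of_mem ?_ (raises_evenEven v N p q _ _ (mon_mem rfl))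
      simp [degree]; omega
    · have := coweight_bounds i
      obtain ⟨rfl, rfl⟩ | ⟨rfl, rfl⟩ | ⟨rfl, rfl⟩ | ⟨rfl, rfl⟩ : (p = 1 ∧ q = 1) ∨ (p = 1 ∧ q = 2) ∨
        (p = 1 ∧ q = 3) ∨ (p = 2 ∧ q = 2) := by omega
      · rw [evenEven_eq hN (M := 2) (by norm_num), evenEven_one_one]
        fin_cases i <;> simp [even_e, evenValue, even_tau, sq1Value]
      · rw [evenEven_eq hN (M := 2) (by norm_num), evenEven_one_two]
        fin_cases i <;>
          simp [even_e, evenValue, even_tau, even_rho, sq1Value, sq1_rho] <;>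
          module
      · rw [evenEven_eq hN (M := 2) (by norm_num), evenEven_one_three]
        fin_cases i <;> simp [even_e, evenValue, even_tau, even_rho, sq1Value, sq1_rho]
      · rw [evenEven_eq hN (M := 3) (by norm_num), evenEven_two_two]
        fin_cases i <;>
          simp [even_e, evenValue, even_tau, even_rho, sq1Value, sq1_rho] <;>
          module
  · intro N p q hp hN hpq
    by_cases hd : 4 < topDegree i - weight i + (p + q + 1)
    · refine eq_zero_of_mem ?_ (raises_evenOdd v N p q _ _ (mon_mem rfl))
      simp [degree]; omega
    · have := coweight_bounds i
      obtain ⟨rfl, rfl⟩ | ⟨rfl, rfl⟩ | ⟨rfl, rfl⟩ : (p = 1 ∧ q = 1) ∨ (p = 2 ∧ q = 1) ∨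
        (p = 1 ∧ q = 2) := by omega
      · rw [evenOdd_eq hN (M := 2) (by norm_num), evenOdd_one_one]
        fin_cases i <;>
          simp [even_e, evenValue, even_rho, sq1Value, sq1_tau, sq1_rho] <;>
          (match_scalars <;> ring_nf <;> reduce_mod_char)
      · rw [evenOdd_eq hN (M := 3) (by norm_num), evenOdd_two_one]
        fin_cases i <;>
          simp [even_e, evenValue, even_tau, even_rho, sq1Value, sq1_tau, sq1_rho] <;>
          module
      · rw [evenOdd_eq hN (M := 2) (by norm_num), evenOdd_one_two]
        fin_cases i <;>
          simp [even_e, evenValue, even_rho, sq1Value, sq1_tau, sq1_rho] <;>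
          (match_scalars <;> ring_nf <;> reduce_mod_char)

end Free8
namespace Free8

/-! ### The model modules -/

variable (v : Fin 7 → ZMod 2)

lemma ademAt_mon (k l : ℕ) (i : Fin 8) : AdemAt tau rho sq1 (even v) (mon k l i) := by
  induction k with
  | zero =>
    induction l with
    | zero => exact ademAt_e v i
    | succ l ih => simpa using (cartanRelations v).ademAt_rho ih
  | succ k ih => simpa using (cartanRelations v).ademAt_tau ih

/-- The action of `𝒜^ℝ` on the free module given by the parameters `v`. -/
noncomputable def action : AR →ₐ[ZMod 2] Module.End (ZMod 2) Free8 :=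
  RingQuot.liftAlgHom (ZMod 2) ⟨wordValue tau rho sq1 (even v), fun _ _ h =>
    (cartanRelations v).wordValue_eq
      (fun p q hpq => sub_eq_zero.1 <| hom_ext fun k l i =>
        (ademAt_mon v k l i).evenEven (by push_cast; omega) (by omega))
      (fun p q hpq => sub_eq_zero.1 <| hom_ext fun k l i =>
        (ademAt_mon v k l i).evenOdd (by push_cast; omega) (by omega)) h⟩

lemma action_gen (g : Gen) : action v (gen g) = genValue tau rho sq1 (even v) g := by
  have h : action v (gen g) = wordValue tau rho sq1 (even v) (FreeAlgebra.ι (ZMod 2) g) :=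
    RingQuot.liftAlgHom_mkAlgHom_apply _ _ _ _
  rw [h, wordValue, FreeAlgebra.lift_ι_apply]

end Free8

/-- The free module `Free8` with the action of `𝒜^ℝ` given by the parameters `v`. -/
def Model (_v : Fin 7 → ZMod 2) : Type := Free8

namespace Model

open Free8

variable (v : Fin 7 → ZMod 2)

noncomputable instance : AddCommGroup (Model v) := inferInstanceAs (AddCommGroup Free8)

noncomputable instance : Module AR (Model v) := Module.compHom Free8 (action v).toRingHom

/-- The bigrading of the model. -/
noncomputable def grading (d : ℤ × ℤ) : AddSubgroup (Model v) := (homogeneous d).toAddSubgroup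

lemma raises_genValue (g : Gen) : Raises (genValue tau rho sq1 (even v) g) g.degree := by
  cases g with
  | tau => exact raises_tau
  | rho => exact raises_rho
  | sq n =>
    obtain ⟨k, rfl | rfl⟩ := n.even_or_odd'
    · simp only [genValue, even_two_mul, if_true, Gen.degree]
      exact (raises_even v _).congr (by ext <;> simp)
    · simp only [genValue, Nat.not_even_bit1, if_false, Gen.degree]
      refine (raises_sq1.mul (raises_even v _)).congr ?_
      rw [show (2 * k + 1) / 2 = k by omega]
      ext <;> simp; ring

lemma isInternal_homogeneous : DirectSum.IsInternal homogeneous := by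
  refine DirectSum.isInternal_submodule_of_iSupIndep_of_iSup_eq_top (fun d => ?_) ?_
  · have h : (⨆ j, ⨆ (_ : j ≠ d), homogeneous j) =
        Finsupp.supported (ZMod 2) (ZMod 2) (⋃ j : {j // j ≠ d}, {p | degree p = j}) := by
      rw [Finsupp.supported_iUnion, iSup_subtype']
      rfl
    rw [h]
    refine Finsupp.disjoint_supported_supported (Set.disjoint_left.2 fun p hp hp' => ?_)
    obtain ⟨⟨j, hj⟩, hp'⟩ := Set.mem_iUnion.1 hp'
    exact hj (hp'.symm.trans hp)
  · have h : iSup homogeneous =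
        Finsupp.supported (ZMod 2) (ZMod 2) (⋃ d, {p | degree p = d}) :=
      (Finsupp.supported_iUnion _).symm
    rw [h, ← Finsupp.supported_univ]
    congr 1
    exact Set.eq_univ_of_forall fun p => Set.mem_iUnion.2 ⟨degree p, rfl⟩

lemma isBigraded : IsBigraded (grading v) where
  isInternal := isInternal_homogeneous
  gen_smul_mem g d m hm := by
    have h := raises_genValue v g d m hm
    rw [← action_gen] at h
    exact h

end Model
/-! ### The subalgebra generated by `Sq^1` and `Sq^2` -/

/-- The projection of the free algebra onto `𝒜^ℝ`. -/
noncomputable def toAR : Words →ₐ[ZMod 2] AR := RingQuot.mkAlgHom (ZMod 2) SteenrodRel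

lemma toAR_eq {x y : Words} (h : SteenrodRel x y) : toAR x = toAR y := RingQuot.mkAlgHom_rel _ h

lemma toAR_surjective : Function.Surjective toAR := RingQuot.mkAlgHom_surjective _ _

@[simp] lemma toAR_tau : toAR wTau = gen .tau := rfl

@[simp] lemma toAR_rho : toAR wRho = gen .rho := rfl

@[simp] lemma toAR_sq (n : ℕ) : toAR (wSq n) = Sq n := rfl

@[simp] lemma Sq_zero : Sq 0 = 1 := by simpa using toAR_eq .sq_zero

lemma tau_mul_rho : gen .tau * gen .rho = gen .rho * gen .tau := by
  simpa using toAR_eq .tau_rho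

lemma Sq_mul_rho (n : ℕ) : Sq n * gen .rho = gen .rho * Sq n := by
  simpa using toAR_eq (.sq_rho n)

lemma Sq_one_mul_tau : Sq 1 * gen .tau = gen .tau * Sq 1 + gen .rho := by
  simpa using toAR_eq .sq_one_tau

lemma Sq_even_mul_tau (n : ℕ) : Sq (2 * n + 2) * gen .tau =
    gen .tau * Sq (2 * n + 2) + gen .tau * gen .rho * Sq (2 * n + 1) := by
  simpa using toAR_eq (.sq_even_tau n)

lemma Sq_odd_mul_tau (n : ℕ) : Sq (2 * n + 3) * gen .tau =
    gen .tau * Sq (2 * n + 3) + gen .rho * Sq (2 * n + 2) + gen .rho ^ 2 * Sq (2 * n + 1) := by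
  simpa using toAR_eq (.sq_odd_tau n)

lemma Sq_mul_Sq (a b : ℕ) (ha : 0 < a) (hab : a < 2 * b) : Sq a * Sq b = toAR (ademRHS a b) := by
  simpa using toAR_eq (.adem a b ha hab)

lemma two_eq_zero {R : Type*} [Ring R] [Algebra (ZMod 2) R] : (2 : R) = 0 := by
  rw [← map_ofNat (algebraMap (ZMod 2) R) 2]
  exact map_zero _

lemma Sq_one_mul_Sq_one : Sq 1 * Sq 1 = 0 := by
  rw [Sq_mul_Sq 1 1 (by norm_num) (by norm_num)]
  simp [ademRHS]

lemma Sq_one_mul_Sq_even (k : ℕ) : Sq 1 * Sq (2 * k + 2) = Sq (2 * k + 3) := by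
  have h : Even (2 * k + 2) := ⟨k + 1, by ring⟩
  rw [Sq_mul_Sq 1 (2 * k + 2) (by norm_num) (by omega)]
  simp [ademRHS, h, two_eq_zero, show 1 + (2 * k + 2) = 2 * k + 3 by ring]

lemma Sq_two_mul_Sq_two : Sq 2 * Sq 2 = gen .tau * Sq 3 * Sq 1 := by
  rw [Sq_mul_Sq 2 2 (by norm_num) (by norm_num)]
  simp [ademRHS, Finset.sum_range_succ]

lemma Sq_two_mul_Sq_three : Sq 2 * Sq 3 = Sq 5 + Sq 4 * Sq 1 + gen .rho * Sq 3 * Sq 1 := by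
  rw [Sq_mul_Sq 2 3 (by norm_num) (by norm_num)]
  simp [ademRHS, Finset.sum_range_succ, show ¬ Even 3 by decide, add_assoc]

lemma Sq_two_mul_Sq_four : Sq 2 * Sq 4 = Sq 6 + gen .tau * Sq 5 * Sq 1 := by
  rw [Sq_mul_Sq 2 4 (by norm_num) (by norm_num)]
  have h : (3 : Words) = 1 := by
    rw [show (3 : Words) = 2 + 1 by norm_num, two_eq_zero, zero_add]
  simp [ademRHS, Finset.sum_range_succ, show Even 4 by decide, h]

lemma Sq_four_mul_Sq_three : Sq 4 * Sq 3 = Sq 5 * Sq 2 := by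
  rw [Sq_mul_Sq 4 3 (by norm_num) (by norm_num)]
  simp [ademRHS, Finset.sum_range_succ, show Even 4 by decide, show ¬ Even 3 by decide,
    show Nat.choose 2 4 = 0 by decide, show Nat.choose 2 5 = 0 by decide,
    show Nat.choose 1 3 = 0 by decide]

lemma Sq_four_mul_Sq_four : Sq 4 * Sq 4 = gen .tau * Sq 7 * Sq 1 + Sq 6 * Sq 2 := by
  rw [Sq_mul_Sq 4 4 (by norm_num) (by norm_num)]
  simp [ademRHS, Finset.sum_range_succ, show Even 4 by decide]

namespace AR1

lemma tau_mul_rho : τ * ρ = ρ * τ := Subtype.ext RMotivic.tau_mul_rho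

lemma sq1_mul_rho : sq1 * ρ = ρ * sq1 := Subtype.ext (Sq_mul_rho 1)

lemma sq2_mul_rho : sq2 * ρ = ρ * sq2 := Subtype.ext (Sq_mul_rho 2)

lemma sq1_mul_tau : sq1 * τ = τ * sq1 + ρ := Subtype.ext Sq_one_mul_tau

lemma sq2_mul_tau : sq2 * τ = τ * sq2 + τ * ρ * sq1 := Subtype.ext (Sq_even_mul_tau 0)

lemma sq1_mul_sq1 : sq1 * sq1 = 0 := Subtype.ext Sq_one_mul_Sq_one

lemma sq2_mul_sq2 : sq2 * sq2 = τ * (sq1 * (sq2 * sq1)) := Subtype.ext <| by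
  change Sq 2 * Sq 2 = gen .tau * (Sq 1 * (Sq 2 * Sq 1))
  rw [Sq_two_mul_Sq_two, ← Sq_one_mul_Sq_even 0]
  simp only [mul_zero, zero_add, mul_assoc]

/-- Both sides are `Sq^5 Sq^1`. -/
lemma sq2_sq1_sq2_sq1 : sq2 * (sq1 * (sq2 * sq1)) = sq1 * (sq2 * (sq1 * sq2)) :=
  Subtype.ext <| by
    have h3 := Sq_one_mul_Sq_even 0
    have h5 := Sq_one_mul_Sq_even 1
    have h := Sq_two_mul_Sq_three
    rw [← h3, ← h5] at h
    have h1 := congrArg (· * Sq 1) h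
    have h2 := congrArg (Sq 1 * ·) h
    have d (x : AR) : Sq 1 * (Sq 1 * x) = 0 := by rw [← mul_assoc, Sq_one_mul_Sq_one, zero_mul]
    have dr (x : AR) : Sq 1 * (gen .rho * x) = gen .rho * (Sq 1 * x) := by
      rw [← mul_assoc, Sq_mul_rho, mul_assoc]
    simp only [mul_zero, zero_add, mul_one, mul_add, add_mul, mul_assoc, Sq_one_mul_Sq_one, d, dr,
      add_zero] at h1 h2
    exact h1.trans h2.symm

/-- The monomial `τ^k ρ^l b_i`, where `b_i` runs through the eight elements `AR1.basis`. -/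
noncomputable def mono (p : Fin 8 × ℕ × ℕ) : AR1 := τ ^ p.2.1 * ρ ^ p.2.2 * basis p.1

lemma tau_mul_mono (k l : ℕ) (i : Fin 8) : τ * mono (i, k, l) = mono (i, k + 1, l) := by
  simp only [mono, pow_succ', mul_assoc]

lemma rho_mul_mono (k l : ℕ) (i : Fin 8) : ρ * mono (i, k, l) = mono (i, k, l + 1) := by
  have h : Commute ρ (τ ^ k) := (show Commute ρ τ from tau_mul_rho.symm).pow_right k
  simp only [mono, pow_succ']
  rw [← mul_assoc, ← mul_assoc, h.eq, mul_assoc (τ ^ k)]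

lemma sq1_sq1_mul (x : AR1) : sq1 * (sq1 * x) = 0 := by rw [← mul_assoc, sq1_mul_sq1, zero_mul]

lemma sq2_sq2_mul (x : AR1) : sq2 * (sq2 * x) = τ * (sq1 * (sq2 * (sq1 * x))) := by
  rw [← mul_assoc, sq2_mul_sq2]; simp only [mul_assoc]

/-- Left multiplication by `Sq^1` on the eight elements. -/
lemma sq1_mul_basis (i : Fin 8) :
    sq1 * basis i = ![x10, 0, x31, 0, y41, 0, y62, 0] i := by
  fin_cases i <;> simp [basis, x10, x31, y41, y62, x21, y31, y52, x00, sq1_sq1_mul, sq1_mul_sq1]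

/-- Left multiplication by `Sq^2` on the eight elements. -/
lemma sq2_mul_basis (i : Fin 8) :
    sq2 * basis i = ![x21, y31, τ * y41, y52, 0, y62, 0, 0] i := by
  fin_cases i <;> simp [basis, x10, x31, y41, y62, x21, y31, y52, x00, sq1_sq1_mul, sq1_mul_sq1,
    sq2_mul_sq2, sq2_sq2_mul, sq2_sq1_sq2_sq1]
  rw [← sq2_sq1_sq2_sq1, sq2_sq2_mul]
  simp [sq1_sq1_mul]

end AR1

/-! ### The basis of `𝒜^ℝ(1)` -/

namespace AR1

/-- The span of the monomials `τ^k ρ^l b_i`. -/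
noncomputable def monoSpan : Submodule (ZMod 2) AR1 := Submodule.span (ZMod 2) (Set.range mono)

lemma mono_mem (p : Fin 8 × ℕ × ℕ) : mono p ∈ monoSpan := Submodule.subset_span ⟨p, rfl⟩

lemma mono_zero (i : Fin 8) : mono (i, 0, 0) = basis i := by simp [mono]

lemma basis_mem (i : Fin 8) : basis i ∈ monoSpan := by
  rw [← mono_zero]; exact mono_mem _

lemma mul_mem_monoSpan {a : AR1} (h : ∀ p, a * mono p ∈ monoSpan) {x : AR1} (hx : x ∈ monoSpan) :
    a * x ∈ monoSpan := by
  induction hx using Submodule.span_induction with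
  | mem y hy => obtain ⟨p, rfl⟩ := hy; exact h p
  | zero => rw [mul_zero]; exact zero_mem _
  | add y z _ _ hy hz => rw [mul_add]; exact add_mem hy hz
  | smul c y _ hy => rw [mul_smul_comm]; exact Submodule.smul_mem _ _ hy

lemma tau_mul_mem {x : AR1} (hx : x ∈ monoSpan) : τ * x ∈ monoSpan :=
  mul_mem_monoSpan (fun p => by rw [tau_mul_mono]; exact mono_mem _) hx

lemma rho_mul_mem {x : AR1} (hx : x ∈ monoSpan) : ρ * x ∈ monoSpan :=
  mul_mem_monoSpan (fun p => by rw [rho_mul_mono]; exact mono_mem _) hx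

/-- Induction over the monomials. -/
lemma mono_induction {P : AR1 → Prop} (hb : ∀ i, P (basis i)) (ht : ∀ x, P x → P (τ * x))
    (hr : ∀ x, P x → P (ρ * x)) (p : Fin 8 × ℕ × ℕ) : P (mono p) := by
  obtain ⟨i, k, l⟩ := p
  induction k with
  | zero =>
    induction l with
    | zero => rw [mono_zero]; exact hb i
    | succ l ih => rw [← rho_mul_mono]; exact hr _ ih
  | succ k ih => rw [← tau_mul_mono]; exact ht _ ih

lemma sq1_mul_mem {x : AR1} (hx : x ∈ monoSpan) : sq1 * x ∈ monoSpan := by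
  refine mul_mem_monoSpan (fun p => ?_) hx
  suffices h : mono p ∈ monoSpan ∧ sq1 * mono p ∈ monoSpan from h.2
  refine mono_induction (P := fun x => x ∈ monoSpan ∧ sq1 * x ∈ monoSpan) (fun i => ?_)
    (fun x h => ?_) (fun x h => ?_) p
  · refine ⟨basis_mem i, ?_⟩
    rw [sq1_mul_basis]
    fin_cases i
    exacts [basis_mem 1, zero_mem _, basis_mem 3, zero_mem _, basis_mem 5, zero_mem _,
      basis_mem 7, zero_mem _]
  · refine ⟨tau_mul_mem h.1, ?_⟩
    rw [← mul_assoc, sq1_mul_tau, add_mul, mul_assoc]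
    exact add_mem (tau_mul_mem h.2) (rho_mul_mem h.1)
  · refine ⟨rho_mul_mem h.1, ?_⟩
    rw [← mul_assoc, sq1_mul_rho, mul_assoc]
    exact rho_mul_mem h.2

lemma sq2_mul_mem {x : AR1} (hx : x ∈ monoSpan) : sq2 * x ∈ monoSpan := by
  refine mul_mem_monoSpan (fun p => ?_) hx
  suffices h : mono p ∈ monoSpan ∧ sq2 * mono p ∈ monoSpan from h.2
  refine mono_induction (P := fun x => x ∈ monoSpan ∧ sq2 * x ∈ monoSpan) (fun i => ?_)
    (fun x h => ?_) (fun x h => ?_) p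
  · refine ⟨basis_mem i, ?_⟩
    rw [sq2_mul_basis]
    fin_cases i
    exacts [basis_mem 2, basis_mem 4, tau_mul_mem (basis_mem 5), basis_mem 6, zero_mem _,
      basis_mem 7, zero_mem _, zero_mem _]
  · refine ⟨tau_mul_mem h.1, ?_⟩
    rw [← mul_assoc, sq2_mul_tau, add_mul, mul_assoc, mul_assoc, mul_assoc]
    exact add_mem (tau_mul_mem h.2) (tau_mul_mem (rho_mul_mem (sq1_mul_mem h.1)))
  · refine ⟨rho_mul_mem h.1, ?_⟩
    rw [← mul_assoc, sq2_mul_rho, mul_assoc]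
    exact rho_mul_mem h.2

/-- The span of the monomials contains `1` and is stable under left multiplication by the
generators, so it is everything. -/
lemma monoSpan_eq_top : monoSpan = ⊤ := by
  have key (a : AR) (ha : a ∈ AR1) : ∀ x ∈ monoSpan, (⟨a, ha⟩ : AR1) * x ∈ monoSpan := by
    induction ha using Algebra.adjoin_induction with
    | mem y hy =>
      rcases hy with rfl | rfl | rfl | rfl
      exacts [fun x => tau_mul_mem, fun x => rho_mul_mem, fun x => sq1_mul_mem,
        fun x => sq2_mul_mem]
    | algebraMap r =>
      intro x hx
      have : (⟨algebraMap (ZMod 2) AR r, AR1.algebraMap_mem r⟩ : AR1) * x = r • x :=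
        (Algebra.smul_def r x).symm
      exact this ▸ Submodule.smul_mem _ r hx
    | add y z hy hz ihy ihz =>
      intro x hx
      exact (add_mul (⟨y, hy⟩ : AR1) ⟨z, hz⟩ x) ▸ add_mem (ihy x hx) (ihz x hx)
    | mul y z hy hz ihy ihz =>
      intro x hx
      exact (mul_assoc (⟨y, hy⟩ : AR1) ⟨z, hz⟩ x) ▸ ihy _ (ihz x hx)
  refine eq_top_iff.2 fun a _ => ?_
  have h1 : (1 : AR1) ∈ monoSpan := basis_mem 0
  simpa using key a a.2 1 h1

/-- The action on the generator `e 0` of the model with parameters `v`. -/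
noncomputable def evalModel (v : Fin 7 → ZMod 2) : AR1 →ₗ[ZMod 2] Free8 where
  toFun a := Free8.action v a (Free8.e 0)
  map_add' a b := by simp
  map_smul' r a := by simp

lemma evalModel_mul (v : Fin 7 → ZMod 2) (a b : AR1) :
    evalModel v (a * b) = Free8.action v a (evalModel v b) := by
  simp [evalModel]

open Free8 in
lemma action_tau (v : Fin 7 → ZMod 2) : action v τ = tau := action_gen v .tau

open Free8 in
lemma action_rho (v : Fin 7 → ZMod 2) : action v ρ = rho := action_gen v .rho

open Free8 in
lemma action_Sq_even (v : Fin 7 → ZMod 2) (k : ℕ) : action v (Sq (2 * k)) = even v k := by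
  rw [Sq, action_gen]; simp [genValue]

open Free8 in
lemma action_sq1 (v : Fin 7 → ZMod 2) : action v sq1 = Free8.sq1 :=
  (action_gen v (.sq 1)).trans (by simp [genValue, (cartanRelations v).s_zero])

open Free8 in
lemma action_sq2 (v : Fin 7 → ZMod 2) : action v sq2 = even v 1 := action_Sq_even v 1

lemma evalModel_basis (v : Fin 7 → ZMod 2) (i : Fin 8) :
    evalModel v (basis i) = Free8.e i := by
  have h0 : evalModel v x00 = Free8.e 0 := by simp [evalModel, x00]
  have h1 : evalModel v x10 = Free8.e 1 := by
    rw [x10, evalModel_mul, h0, action_sq1]; simp [Free8.sq1Value]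
  have h2 : evalModel v x21 = Free8.e 2 := by
    rw [x21, evalModel_mul, h0, action_sq2]; simp [Free8.even_e, Free8.evenValue]
  have h3 : evalModel v x31 = Free8.e 3 := by
    rw [x31, evalModel_mul, h2, action_sq1]; simp [Free8.sq1Value]
  have h4 : evalModel v y31 = Free8.e 4 := by
    rw [y31, evalModel_mul, h1, action_sq2]; simp [Free8.even_e, Free8.evenValue]
  have h5 : evalModel v y41 = Free8.e 5 := by
    rw [y41, evalModel_mul, h4, action_sq1]; simp [Free8.sq1Value]
  have h6 : evalModel v y52 = Free8.e 6 := by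
    rw [y52, evalModel_mul, h3, action_sq2]; simp [Free8.even_e, Free8.evenValue]
  have h7 : evalModel v y62 = Free8.e 7 := by
    rw [y62, evalModel_mul, h6, action_sq1]; simp [Free8.sq1Value]
  fin_cases i
  exacts [h0, h1, h2, h3, h4, h5, h6, h7]

lemma evalModel_mono (v : Fin 7 → ZMod 2) (i : Fin 8) (k l : ℕ) :
    evalModel v (mono (i, k, l)) = Free8.mon k l i := by
  rw [← Free8.tau_pow_rho_pow, mono, mul_assoc, evalModel_mul, evalModel_mul, evalModel_basis]
  simp [action_tau, action_rho]

/-- The isomorphism of `𝔽₂`-vector spaces that reads off the coordinates of an element of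
`𝒜^ℝ(1)` with respect to the monomials `τ^k ρ^l b_i`. -/
noncomputable def coord : AR1 ≃ₗ[ZMod 2] Free8 :=
  .symm <| .ofBijective
    (Finsupp.linearCombination (ZMod 2) fun p : ℕ × ℕ × Fin 8 => mono (p.2.2, p.1, p.2.1)) <| by
  constructor
  · have h : (evalModel 0).comp (Finsupp.linearCombination (ZMod 2)
        fun p : ℕ × ℕ × Fin 8 => mono (p.2.2, p.1, p.2.1)) = LinearMap.id :=
      Free8.hom_ext fun k l i => by
        rw [LinearMap.comp_apply, Free8.linearCombination_mon, evalModel_mono, LinearMap.id_apply]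
    exact Function.LeftInverse.injective (g := evalModel 0) (LinearMap.congr_fun h)
  · rw [← LinearMap.range_eq_top, Finsupp.range_linearCombination, ← monoSpan_eq_top, monoSpan]
    congr 1
    ext x
    exact ⟨fun ⟨p, hp⟩ => ⟨_, hp⟩, fun ⟨p, hp⟩ => ⟨(p.2.1, p.2.2, p.1), hp⟩⟩

lemma coord_symm_mon (k l : ℕ) (i : Fin 8) : coord.symm (Free8.mon k l i) = mono (i, k, l) :=
  Free8.linearCombination_mon _ _ _ _

lemma coord_mono (i : Fin 8) (k l : ℕ) : coord (mono (i, k, l)) = Free8.mon k l i := by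
  rw [← coord_symm_mon, LinearEquiv.apply_symm_apply]

/-- In every model, the action of `𝒜^ℝ(1)` on the generator reads off the coordinates. -/
lemma evalModel_eq_coord (v : Fin 7 → ZMod 2) (a : AR1) : evalModel v a = coord a := by
  have h : (evalModel v).comp coord.symm.toLinearMap = LinearMap.id :=
    Free8.hom_ext fun k l i => by
      simp [coord_symm_mon, evalModel_mono]
  simpa using LinearMap.congr_fun h (coord a)

lemma coord_mul (v : Fin 7 → ZMod 2) (a b : AR1) :
    coord (a * b) = Free8.action v a (coord b) := by
  rw [← evalModel_eq_coord v, evalModel_mul, evalModel_eq_coord]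

@[simp] lemma coord_tau_mul (a : AR1) : coord (τ * a) = Free8.tau (coord a) := by
  rw [coord_mul 0, action_tau]

@[simp] lemma coord_rho_mul (a : AR1) : coord (ρ * a) = Free8.rho (coord a) := by
  rw [coord_mul 0, action_rho]

@[simp] lemma coord_basis (i : Fin 8) : coord (basis i) = Free8.e i := by
  rw [← mono_zero, coord_mono]; rfl

lemma isCoefficientBasis : IsCoefficientBasis basis := by
  refine ⟨?_, monoSpan_eq_top⟩
  refine LinearIndependent.of_comp coord.toLinearMap ?_
  have h : (coord.toLinearMap ∘ fun p : Fin 8 × ℕ × ℕ => τ ^ p.2.1 * ρ ^ p.2.2 * basis p.1) =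
      (fun p : ℕ × ℕ × Fin 8 => (Finsupp.single p 1 : Free8)) ∘
        fun p : Fin 8 × ℕ × ℕ => (p.2.1, p.2.2, p.1) :=
    funext fun p => coord_mono p.1 p.2.1 p.2.2
  rw [h]
  refine (Finsupp.linearIndependent_single_one (ZMod 2) (ℕ × ℕ × Fin 8)).comp _ fun p q hpq => ?_
  simp only [Prod.mk.injEq] at hpq
  ext1
  exacts [hpq.2.2, Prod.ext hpq.1 hpq.2.1]

end AR1
/-! ### Bigradings -/

lemma gen_mem_homogeneous (g : Gen) : gen g ∈ AR.homogeneous g.degree :=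
  AddSubgroup.subset_closure ⟨[g], by simp⟩

lemma one_mem_homogeneous : (1 : AR) ∈ AR.homogeneous 0 :=
  AddSubgroup.subset_closure ⟨[], by simp⟩

lemma mul_mem_homogeneous {d e : ℤ × ℤ} {x y : AR} (hx : x ∈ AR.homogeneous d)
    (hy : y ∈ AR.homogeneous e) : x * y ∈ AR.homogeneous (d + e) := by
  induction hy using AddSubgroup.closure_induction with
  | mem y hy =>
    obtain ⟨m, rfl, rfl⟩ := hy
    induction hx using AddSubgroup.closure_induction with
    | mem x hx =>
      obtain ⟨l, rfl, rfl⟩ := hx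
      exact AddSubgroup.subset_closure ⟨l ++ m, by simp⟩
    | zero => rw [zero_mul]; exact zero_mem _
    | add x y _ _ h1 h2 => rw [add_mul]; exact add_mem h1 h2
    | neg x _ h => rw [neg_mul]; exact neg_mem h
  | zero => rw [mul_zero]; exact zero_mem _
  | add x y _ _ h1 h2 => rw [mul_add]; exact add_mem h1 h2
  | neg x _ h => rw [mul_neg]; exact neg_mem h

lemma pow_mem_homogeneous {d : ℤ × ℤ} {x : AR} (hx : x ∈ AR.homogeneous d) (n : ℕ) :
    x ^ n ∈ AR.homogeneous (n • d) := by
  induction n with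
  | zero => simpa using one_mem_homogeneous
  | succ n ih => rw [pow_succ, succ_nsmul]; exact mul_mem_homogeneous ih hx

lemma IsBigraded.smul_mem {M : Type*} [AddCommGroup M] [Module AR M]
    {ℳ : ℤ × ℤ → AddSubgroup M} (h : IsBigraded ℳ) {d e : ℤ × ℤ} {a : AR} {m : M}
    (ha : a ∈ AR.homogeneous d) (hm : m ∈ ℳ e) : a • m ∈ ℳ (d + e) := by
  induction ha using AddSubgroup.closure_induction with
  | mem x hx =>
    obtain ⟨l, rfl, rfl⟩ := hx
    induction l with
    | nil => simpa using hm
    | cons g l ih =>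
      have := h.gen_smul_mem g _ _ ih
      simp only [List.map_cons, List.prod_cons, List.sum_cons, mul_smul]
      convert this using 1
      rw [add_comm _ g.degree, ← add_assoc]
  | zero => rw [zero_smul]; exact zero_mem _
  | add x y _ _ hx hy => rw [add_smul]; exact add_mem hx hy
  | neg x _ hx => rw [neg_smul]; exact neg_mem hx

namespace AR1

lemma basis_mem_homogeneous (i : Fin 8) :
    basis i ∈ homogeneous (Free8.degree (0, 0, i)) := by
  have mul {a b : AR1} {c d e : ℤ × ℤ} (ha : a ∈ homogeneous c) (hb : b ∈ homogeneous d)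
      (h : c + d = e) : a * b ∈ homogeneous e := h ▸ mul_mem_homogeneous ha hb
  have s1 : sq1 ∈ homogeneous (1, 0) := gen_mem_homogeneous (.sq 1)
  have s2 : sq2 ∈ homogeneous (2, 1) := gen_mem_homogeneous (.sq 2)
  have h0 : x00 ∈ homogeneous (0, 0) := one_mem_homogeneous
  have h1 : x10 ∈ homogeneous (1, 0) := mul s1 h0 (by simp)
  have h2 : x21 ∈ homogeneous (2, 1) := mul s2 h0 (by simp)
  have h3 : x31 ∈ homogeneous (3, 1) := mul s1 h2 (by simp)
  have h4 : y31 ∈ homogeneous (3, 1) := mul s2 h1 (by simp)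
  have h5 : y41 ∈ homogeneous (4, 1) := mul s1 h4 (by simp)
  have h6 : y52 ∈ homogeneous (5, 2) := mul s2 h3 (by simp)
  have h7 : y62 ∈ homogeneous (6, 2) := mul s1 h6 (by simp)
  have e : Free8.degree (0, 0, i) =
      ![(0, 0), (1, 0), (2, 1), (3, 1), (3, 1), (4, 1), (5, 2), (6, 2)] i := by
    revert i; decide
  rw [e]
  fin_cases i
  exacts [h0, h1, h2, h3, h4, h5, h6, h7]

lemma mono_mem_homogeneous (i : Fin 8) (k l : ℕ) :
    mono (i, k, l) ∈ homogeneous (Free8.degree (k, l, i)) := by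
  have h := mul_mem_homogeneous (mul_mem_homogeneous
    (pow_mem_homogeneous (gen_mem_homogeneous .tau) k)
    (pow_mem_homogeneous (gen_mem_homogeneous .rho) l)) (basis_mem_homogeneous i)
  have e : k • Gen.tau.degree + l • Gen.rho.degree + Free8.degree (0, 0, i) =
      Free8.degree (k, l, i) := by
    ext <;> simp [Gen.degree, Free8.degree]
  rw [e] at h
  exact h

/-- An element of `𝒜^ℝ(1)` is homogeneous in `𝒜^ℝ` if and only if its coordinates are. One
direction is seen from the action on the generator of a model. -/
lemma mem_homogeneous_iff {d : ℤ × ℤ} {a : AR1} :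
    a ∈ homogeneous d ↔ coord a ∈ Free8.homogeneous d := by
  constructor
  · intro h
    rw [← evalModel_eq_coord 0]
    have h1 := (Model.isBigraded 0).smul_mem (m := Free8.e 0) (e := 0) h
      (Free8.mon_mem (d := 0) (by decide))
    rwa [add_zero] at h1
  · intro h
    rw [← LinearEquiv.symm_apply_apply coord a]
    generalize coord a = x at h
    rw [Free8.homogeneous, Finsupp.supported_eq_span_single] at h
    induction h using Submodule.span_induction with
    | mem y hy =>
      obtain ⟨⟨k, l, i⟩, rfl, rfl⟩ := hy
      change coord.symm (Free8.mon k l i) ∈ _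
      rw [coord_symm_mon]
      exact mono_mem_homogeneous i k l
    | zero => rw [map_zero]; exact zero_mem _
    | add y z _ _ hy hz => rw [map_add]; exact add_mem hy hz
    | smul c y _ hy =>
      rw [map_smul]
      obtain rfl | rfl : c = 0 ∨ c = 1 := by revert c; decide
      · rw [zero_smul]; exact zero_mem _
      · rwa [one_smul]

lemma isInternal_homogeneous : DirectSum.IsInternal homogeneous := by
  let f (d : ℤ × ℤ) : homogeneous d ≃+ Free8.homogeneous d :=
    { toFun x := ⟨coord x, mem_homogeneous_iff.1 x.2⟩
      invFun x := ⟨coord.symm x, mem_homogeneous_iff.2 (by simp)⟩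
      left_inv x := by simp
      right_inv x := by simp
      map_add' x y := by ext1; simp }
  let F := DFinsupp.mapRange.addEquiv f
  have h : (coord : AR1 →+ Free8).comp (DirectSum.coeAddMonoidHom homogeneous) =
      (DirectSum.coeAddMonoidHom Free8.homogeneous).comp F.toAddMonoidHom := by
    refine DirectSum.addHom_ext fun d x => ?_
    have hF : F (DirectSum.of (fun d => homogeneous d) d x) =
        DirectSum.of (fun d => Free8.homogeneous d) d (f d x) :=
      DFinsupp.mapRange_single (hf := fun d => map_zero (f d))
    simp [hF, f]
  have h2 : Function.Bijective (coord ∘ DirectSum.coeAddMonoidHom homogeneous) := by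
    have e : coord ∘ DirectSum.coeAddMonoidHom homogeneous =
        DirectSum.coeAddMonoidHom Free8.homogeneous ∘ F := funext fun x => DFunLike.congr_fun h x
    rw [e]
    exact Model.isInternal_homogeneous.comp F.bijective
  exact (coord.bijective.of_comp_iff' _).1 h2

end AR1

/-- A bigraded `𝒜^ℝ`-module `M` which is free on one generator `g` over `𝒜^ℝ(1)` transports to an
`𝒜^ℝ`-module structure on `𝒜^ℝ(1)` along `x ↦ x g`. -/
lemma exists_moduleStructure {M : Type*} [AddCommGroup M] [Module AR M]
    {ℳ : ℤ × ℤ → AddSubgroup M} (hM : IsBigraded ℳ) {s : ℤ × ℤ} {g : M} (hg : g ∈ ℳ s)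
    (hb : Function.Bijective fun a : AR1 => (a : AR) • g) :
    ∃ S : ModuleStructure, (∀ (a : AR) (x : AR1), (S.act a x : AR) • g = a • (x : AR) • g) ∧
      IsoSuspension s S.grading ℳ := by
  classical
  let ψ : AR1 ≃+ M := .ofBijective
    ({ toFun a := (a : AR) • g
       map_zero' := by simp
       map_add' a b := by simp [add_smul] } : AR1 →+ M) hb
  have ψ_apply (a : AR1) : ψ a = (a : AR) • g := rfl
  let : SMul AR AR1 := ⟨fun a x => ψ.symm (a • ψ x)⟩
  have smul_def (a : AR) (x : AR1) : ψ (a • x) = a • ψ x := ψ.apply_symm_apply _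
  let mod : Module AR AR1 := Function.Injective.module AR (ψ : AR1 →+ M) ψ.injective smul_def
  have hmem {d : ℤ × ℤ} {x : AR1} : x ∈ AR1.homogeneous d ↔ ψ x ∈ ℳ (d + s) := by
    refine ⟨fun h => hM.smul_mem h hg, fun h => ?_⟩
    -- compare the homogeneous components of `x` with those of `ψ x`
    let := AR1.isInternal_homogeneous.chooseDecomposition
    let := hM.isInternal.chooseDecomposition
    have key (y : AR1) (e : ℤ × ℤ) :
        ψ (DirectSum.decompose AR1.homogeneous y e) = DirectSum.decompose ℳ (ψ y) (e + s) := by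
      induction y using DirectSum.Decomposition.inductionOn AR1.homogeneous with
      | zero => simp
      | @homogeneous i m =>
        have hm : ψ m ∈ ℳ (i + s) := hM.smul_mem m.2 hg
        rcases eq_or_ne i e with rfl | hie
        · rw [DirectSum.decompose_of_mem_same _ m.2, DirectSum.decompose_of_mem_same _ hm]
        · rw [DirectSum.decompose_of_mem_ne _ m.2 hie, DirectSum.decompose_of_mem_ne _ hm
            (fun h => hie (add_right_cancel h)), map_zero]
      | add y z hy hz =>
        simp only [DirectSum.decompose_add, DirectSum.add_apply, AddSubgroup.coe_add, map_add,
          hy, hz]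
    have hx : (DirectSum.decompose AR1.homogeneous x d : AR1) = x := by
      refine ψ.injective ?_
      rw [key, DirectSum.decompose_of_mem_same _ h]
    rw [← hx]
    exact SetLike.coe_mem _
  let S : ModuleStructure :=
    { module := mod
      smul_eq_mul a b := ψ.injective <| by
        rw [smul_def, ψ_apply, ψ_apply, Subalgebra.coe_mul, mul_smul]
      isBigraded :=
        { isInternal := AR1.isInternal_homogeneous
          gen_smul_mem a d m hm := by
            rw [hmem] at hm ⊢
            rw [smul_def, add_right_comm]
            exact hM.gen_smul_mem a _ _ hm } }
  exact ⟨S, smul_def, { ψ with map_smul' := smul_def }, fun d m => hmem⟩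

/-! ### Module structures as actions on coordinates -/

namespace ModuleStructure

open AR1

variable (S : ModuleStructure)

lemma act_mul (a b : AR) (x : AR1) : S.act (a * b) x = S.act a (S.act b x) :=
  mul_smul (α := AR) (β := S.Carrier) a b x

lemma act_one (x : AR1) : S.act 1 x = x := one_smul AR (show S.Carrier from x)

lemma act_add (a : AR) (x y : AR1) : S.act a (x + y) = S.act a x + S.act a y :=
  smul_add (M := AR) (A := S.Carrier) a x y

lemma act_zero (a : AR) : S.act a 0 = 0 := smul_zero (M := AR) (A := S.Carrier) a

lemma add_act (a b : AR) (x : AR1) : S.act (a + b) x = S.act a x + S.act b x :=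
  add_smul (R := AR) (M := S.Carrier) a b x

lemma zero_act (x : AR1) : S.act 0 x = 0 := zero_smul AR (show S.Carrier from x)

lemma act_coe (a x : AR1) : S.act a x = a * x := S.smul_eq_mul a x

/-- The action of `𝒜^ℝ` given by `S`, in the coordinates of `𝒜^ℝ(1)`. -/
noncomputable def op : AR →ₐ[ZMod 2] Module.End (ZMod 2) Free8 where
  toFun a :=
    { toFun x := coord (S.act a (coord.symm x))
      map_add' x y := by simp [act_add]
      map_smul' c x := by
        obtain rfl | rfl : c = 0 ∨ c = 1 := by revert c; decide
        · simp [act_zero]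
        · simp }
  map_one' := LinearMap.ext fun x => by simp [act_one]
  map_mul' a b := LinearMap.ext fun x => by simp [act_mul]
  map_zero' := LinearMap.ext fun x => by simp [zero_act]
  map_add' a b := LinearMap.ext fun x => by simp [add_act]
  commutes' c := LinearMap.ext fun x => by
    obtain rfl | rfl : c = 0 ∨ c = 1 := by revert c; decide
    · simp [zero_act]
    · simp [act_one]

lemma op_coord (a : AR) (x : AR1) : S.op a (coord x) = coord (S.act a x) := by
  simp [op]

lemma op_coe (v : Fin 7 → ZMod 2) (a : AR1) : S.op a = Free8.action v a :=
  LinearMap.ext fun x => by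
    obtain ⟨x, rfl⟩ := coord.surjective x
    rw [op_coord, act_coe, coord_mul v]

lemma raises_op {d : ℤ × ℤ} {a : AR} (ha : a ∈ AR.homogeneous d) : Free8.Raises (S.op a) d := by
  intro e x hx
  obtain ⟨x, rfl⟩ := coord.surjective x
  rw [op_coord, ← mem_homogeneous_iff, add_comm]
  let := S.module
  exact S.isBigraded.smul_mem ha (mem_homogeneous_iff.2 hx)

lemma ext_op {S T : ModuleStructure} (h : S.op = T.op) : S = T := by
  have h1 : S.module = T.module := Module.ext' _ _ fun a x => coord.injective <| by
    have := S.op_coord a x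
    rw [h, T.op_coord] at this
    exact this.symm
  cases S
  cases T
  cases h1
  rfl

end ModuleStructure

/-- A homomorphism from `𝒜^ℝ` is determined by the images of the generators. -/
lemma AR.algHom_ext {R : Type*} [Ring R] [Algebra (ZMod 2) R] {f g : AR →ₐ[ZMod 2] R}
    (h : ∀ x : Gen, f (gen x) = g (gen x)) : f = g := by
  have h1 : f.comp toAR = g.comp toAR := FreeAlgebra.hom_ext (funext h)
  refine AlgHom.ext fun a => ?_
  obtain ⟨w, rfl⟩ := toAR_surjective a
  exact DFunLike.congr_fun h1 w

namespace Free8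

variable (v : Fin 7 → ZMod 2)

/-- By the Cartan formula, an action of `Sq^n` is determined by the lower squares and by its values
on the generators. -/
lemma map_Sq_eq {f g : AR →ₐ[ZMod 2] Module.End (ZMod 2) Free8} (hft : f (gen .tau) = tau)
    (hfr : f (gen .rho) = rho) (hgt : g (gen .tau) = tau) (hgr : g (gen .rho) = rho) {n : ℕ}
    (hn : 2 ≤ n) (hlt : ∀ m < n, f (Sq m) = g (Sq m))
    (he : ∀ i, f (Sq n) (e i) = g (Sq n) (e i)) : f (Sq n) = g (Sq n) := by
  refine hom_ext_of_stable he (fun x hx => ?_) (fun x hx => ?_)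
  · rw [← hft, ← Module.End.mul_apply, ← map_mul, hft, ← hgt, ← Module.End.mul_apply, ← map_mul]
    obtain ⟨k, rfl | rfl⟩ : ∃ k, n = 2 * k + 2 ∨ n = 2 * k + 3 := ⟨(n - 2) / 2, by omega⟩
    · rw [Sq_even_mul_tau]
      simp only [map_add, map_mul, hft, hfr, hgt, hgr, LinearMap.add_apply, Module.End.mul_apply,
        hx, hlt (2 * k + 1) (by omega)]
    · rw [Sq_odd_mul_tau]
      simp only [map_add, map_mul, map_pow, hft, hfr, hgt, hgr, LinearMap.add_apply,
        Module.End.mul_apply, hx, hlt (2 * k + 1) (by omega), hlt (2 * k + 2) (by omega)]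
  · rw [← hfr, ← Module.End.mul_apply, ← map_mul, hfr, ← hgr, ← Module.End.mul_apply, ← map_mul,
      Sq_mul_rho]
    simp only [map_mul, hfr, hgr, Module.End.mul_apply, hx]

lemma raises_action (n : ℕ) : Raises (action v (Sq n)) (Gen.sq n).degree := by
  rw [Sq, action_gen]
  exact Model.raises_genValue v (.sq n)

lemma mem_zero_of_raises {f : Module.End (ZMod 2) Free8} {n : ℕ}
    (hf : Raises f (Gen.sq n).degree) {i : Fin 8}
    (hi : 4 < topDegree i - weight i + ((n : ℤ) - (n / 2 : ℕ))) : f (e i) = 0 := by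
  refine eq_zero_of_mem ?_ (hf _ _ (mon_mem rfl))
  simp only [degree, Gen.degree, Prod.fst_add, Prod.snd_add]
  push_cast at hi ⊢
  omega

/-- A degree-preserving action of `𝒜^ℝ` which extends that of `𝒜^ℝ(1)` is determined by the values
of `Sq^4` on the generators and of `Sq^8` on the first one. -/
lemma eq_action {f : AR →ₐ[ZMod 2] Module.End (ZMod 2) Free8} (ht : f (gen .tau) = tau)
    (hr : f (gen .rho) = rho) (h1 : f (Sq 1) = action v (Sq 1)) (h2 : f (Sq 2) = action v (Sq 2))
    (hd : ∀ n, Raises (f (Sq n)) (Gen.sq n).degree)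
    (h4 : ∀ i : Fin 8, i < 5 → f (Sq 4) (e i) = evenValue v 2 i)
    (h8 : f (Sq 8) (e 0) = evenValue v 4 0) : f = action v := by
  have hgt : action v (gen .tau) = tau := action_gen v .tau
  have hgr : action v (gen .rho) = rho := action_gen v .rho
  have h0 : f (Sq 0) = action v (Sq 0) := by rw [Sq_zero, map_one, map_one]
  have h3 : f (Sq 3) = action v (Sq 3) := by
    rw [← Sq_one_mul_Sq_even 0]; simp only [mul_zero, zero_add, map_mul, h1, h2]
  have h4' : f (Sq 4) = action v (Sq 4) := by
    refine map_Sq_eq ht hr hgt hgr (by norm_num) (fun m hm => ?_) (fun i => ?_)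
    · interval_cases m <;> assumption
    · by_cases hi : i < 5
      · rw [h4 i hi, AR1.action_Sq_even v 2, even_e]; rfl
      · have hi' : 4 < topDegree i - weight i + (((4 : ℕ) : ℤ) - (4 / 2 : ℕ)) := by
          revert i; decide
        rw [mem_zero_of_raises (hd 4) hi', mem_zero_of_raises (raises_action v 4) hi']
  have h5 : f (Sq 5) = action v (Sq 5) := by
    rw [← Sq_one_mul_Sq_even 1]; simp only [mul_one, Nat.reduceAdd, map_mul, h1, h4']
  have h6 : f (Sq 6) = action v (Sq 6) := by
    rw [show Sq 6 = _ from eq_sub_of_add_eq Sq_two_mul_Sq_four.symm]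
    simp only [map_sub, map_mul, h1, h2, h4', h5, ht, hgt]
  have h7 : f (Sq 7) = action v (Sq 7) := by
    rw [← Sq_one_mul_Sq_even 2]; simp only [Nat.reduceMul, Nat.reduceAdd, map_mul, h1, h6]
  have h8' : f (Sq 8) = action v (Sq 8) := by
    refine map_Sq_eq ht hr hgt hgr (by norm_num) (fun m hm => ?_) (fun i => ?_)
    · interval_cases m <;> assumption
    · rcases eq_or_ne i 0 with rfl | hi
      · rw [h8, AR1.action_Sq_even v 4, even_e]; rfl
      · have hi' : 4 < topDegree i - weight i + (((8 : ℕ) : ℤ) - (8 / 2 : ℕ)) := by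
          revert i; decide
        rw [mem_zero_of_raises (hd 8) hi', mem_zero_of_raises (raises_action v 8) hi']
  refine AR.algHom_ext (R := Module.End (ZMod 2) Free8) fun x => ?_
  cases x with
  | tau => rw [ht, hgt]
  | rho => rw [hr, hgr]
  | sq n =>
    change f (Sq n) = action v (Sq n)
    induction n using Nat.strong_induction_on with
    | _ n ih =>
      rcases lt_or_ge n 9 with hn | hn
      · interval_cases n <;> assumption
      · refine map_Sq_eq ht hr hgt hgr (by omega) ih (fun i => ?_)
        have hi' : 4 < topDegree i - weight i + ((n : ℤ) - (n / 2 : ℕ)) := by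
          have := coweight_bounds i
          omega
        rw [mem_zero_of_raises (hd n) hi', mem_zero_of_raises (raises_action v n) hi']

/-- The parameters can be read off from the values of `Sq^4` and `Sq^8`. -/
lemma action_injective {v w : Fin 7 → ZMod 2} (h : action v = action w) : v = w := by
  have h4 (i : Fin 8) : evenValue v 2 i = evenValue w 2 i := by
    rw [← even_e, ← even_e]
    have := AR1.action_Sq_even v 2
    rw [h, AR1.action_Sq_even w 2] at this
    exact (LinearMap.congr_fun this (e i)).symm
  have h8 : evenValue v 4 0 = evenValue w 4 0 := by
    rw [← even_e, ← even_e]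
    have := AR1.action_Sq_even v 4
    rw [h, AR1.action_Sq_even w 4] at this
    exact (LinearMap.congr_fun this (e 0)).symm
  have e0 := DFunLike.congr_fun (h4 0) (0, 1, 3)
  have e1 := DFunLike.congr_fun (h4 0) (0, 1, 4)
  have e2 := DFunLike.congr_fun (h4 1) (0, 1, 5)
  have e3 := DFunLike.congr_fun h8 (0, 2, 7)
  have e4 := DFunLike.congr_fun (h4 2) (0, 1, 6)
  have e5 := DFunLike.congr_fun (h4 2) (1, 0, 7)
  have e6 := DFunLike.congr_fun (h4 4) (0, 1, 7)
  simp [evenValue, e] at e0 e1 e2 e3 e4 e5 e6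
  simp [mon] at e0 e1 e2 e3 e4 e5 e6
  funext j
  fin_cases j <;> assumption

end Free8

/-! ### Classification -/

namespace Free8

lemma eq_sum_of_mem {d : ℤ × ℤ} {x : Free8} (hx : x ∈ homogeneous d)
    (F : Finset (ℕ × ℕ × Fin 8)) (hF : ∀ k l i, degree (k, l, i) = d → (k, l, i) ∈ F) :
    x = ∑ p ∈ F, x p • mon p.1 p.2.1 p.2.2 := by
  have h : x.support ⊆ F := fun p hp => hF p.1 p.2.1 p.2.2 ((Finsupp.mem_supported _ _).1 hx hp)
  conv_lhs => rw [← Finsupp.sum_single x, Finsupp.sum_of_support_subset x h _ (by simp)]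
  exact Finset.sum_congr rfl fun p _ => by simp [mon]

end Free8

namespace ModuleStructure

open Free8
open AR1 (coord)

variable (S : ModuleStructure)

/-- The formulas of `v` hold exactly if the action agrees, in coordinates, with that of the
model. -/
lemma listed_iff {v : Fin 7 → ZMod 2} : Listed v S ↔ S.op = action v := by
  have c0 : coord AR1.x00 = e 0 := AR1.coord_basis 0
  have c1 : coord AR1.x10 = e 1 := AR1.coord_basis 1
  have c2 : coord AR1.x21 = e 2 := AR1.coord_basis 2
  have c3 : coord AR1.x31 = e 3 := AR1.coord_basis 3
  have c4 : coord AR1.y31 = e 4 := AR1.coord_basis 4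
  have c5 : coord AR1.y41 = e 5 := AR1.coord_basis 5
  have c6 : coord AR1.y52 = e 6 := AR1.coord_basis 6
  have c7 : coord AR1.y62 = e 7 := AR1.coord_basis 7
  constructor
  · rintro ⟨h0, h1, h2, h3, h4, h8⟩
    have mem (n : ℕ) : Sq n ∈ AR.homogeneous (Gen.sq n).degree := gen_mem_homogeneous _
    refine eq_action v (S.op_coe v AR1.τ |>.trans (AR1.action_tau v))
      (S.op_coe v AR1.ρ |>.trans (AR1.action_rho v)) (S.op_coe v AR1.sq1) (S.op_coe v AR1.sq2)
      (fun n => S.raises_op (mem n)) (fun i hi => ?_) ?_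
    · obtain rfl | rfl | rfl | rfl | rfl : i = 0 ∨ i = 1 ∨ i = 2 ∨ i = 3 ∨ i = 4 := by
        revert i; decide
      · rw [← c0, op_coord, h0]; simp [evenValue, c3, c4, c5]
      · rw [← c1, op_coord, h1]; simp [evenValue, c5, c6]
      · rw [← c2, op_coord, h2]; simp [evenValue, pow_two, mul_assoc, c5, c6, c7]
      · rw [← c3, op_coord, h3]; simp [evenValue, c7]
      · rw [← c4, op_coord, h4]; simp [evenValue, c7]
    · rw [← c0, op_coord, h8]; simp [evenValue, pow_two, mul_assoc, c7]
  · intro h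
    have h4 (x : AR1) : coord (S.act (Sq 4) x) = even v 2 (coord x) := by
      rw [← op_coord, h, AR1.action_Sq_even v 2]; rfl
    have h8 (x : AR1) : coord (S.act (Sq 8) x) = even v 4 (coord x) := by
      rw [← op_coord, h, AR1.action_Sq_even v 4]; rfl
    constructor <;> apply coord.injective
    · rw [h4, c0, even_e]; simp [evenValue, c3, c4, c5]
    · rw [h4, c1, even_e]; simp [evenValue, c5, c6]
    · rw [h4, c2, even_e]; simp [evenValue, pow_two, mul_assoc, c5, c6, c7]
    · rw [h4, c3, even_e]; simp [evenValue, c7]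
    · rw [h4, c4, even_e]; simp [evenValue, c7]
    · rw [h8, c0, even_e]; simp [evenValue, pow_two, mul_assoc, c7]

/-- For degree reasons only eleven coefficients occur in the values of `Sq^4` and `Sq^8`; the Adem
relations for `Sq^2 Sq^3`, `Sq^4 Sq^3` and `Sq^4 Sq^4` on the generator leave seven free. -/
lemma exists_listed : ∃ v, Listed v S := by
  have mem (n : ℕ) : Sq n ∈ AR.homogeneous (Gen.sq n).degree := gen_mem_homogeneous _
  have ft : S.op (gen .tau) = tau := S.op_coe 0 AR1.τ |>.trans (AR1.action_tau 0)
  have fr : S.op (gen .rho) = rho := S.op_coe 0 AR1.ρ |>.trans (AR1.action_rho 0)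
  have f1 : S.op (Sq 1) = sq1 := S.op_coe 0 AR1.sq1 |>.trans (AR1.action_sq1 0)
  have f2 : S.op (Sq 2) = even 0 1 := S.op_coe 0 AR1.sq2 |>.trans (AR1.action_sq2 0)
  have f3 : S.op (Sq 3) = sq1 * even 0 1 := by
    rw [← Sq_one_mul_Sq_even 0]; simp only [mul_zero, zero_add, map_mul, f1, f2]
  have f5 : S.op (Sq 5) = sq1 * S.op (Sq 4) := by
    rw [← Sq_one_mul_Sq_even 1]; simp only [mul_one, Nat.reduceAdd, map_mul, f1]
  have f6 : S.op (Sq 6) = even 0 1 * S.op (Sq 4) - tau * (sq1 * S.op (Sq 4)) * sq1 := by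
    rw [show Sq 6 = _ from eq_sub_of_add_eq Sq_two_mul_Sq_four.symm]
    simp only [map_sub, map_mul, f1, f2, f5, ft]
  have f7 : S.op (Sq 7) = sq1 * S.op (Sq 6) := by
    rw [← Sq_one_mul_Sq_even 2]; simp only [Nat.reduceMul, Nat.reduceAdd, map_mul, f1]
  have r (x : Free8) : S.op (Sq 4) (rho x) = rho (S.op (Sq 4) x) := by
    have := congrArg S.op (Sq_mul_rho 4)
    rw [map_mul, map_mul, fr] at this
    exact LinearMap.congr_fun this x
  have t (x : Free8) : S.op (Sq 4) (tau x) =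
      tau (S.op (Sq 4) x) + tau (rho (sq1 (even 0 1 x))) := by
    have := congrArg S.op (Sq_even_mul_tau 1)
    simp only [map_mul, map_add, fr, ft, mul_one, Nat.reduceAdd, f3] at this
    exact LinearMap.congr_fun this x
  have m4 (i : Fin 8) : S.op (Sq 4) (e i) ∈ homogeneous (degree (0, 0, i) + (4, 2)) :=
    S.raises_op (mem 4) _ _ (mon_mem rfl)
  have m8 : S.op (Sq 8) (e 0) ∈ homogeneous (degree (0, 0, 0) + (8, 4)) :=
    S.raises_op (mem 8) _ _ (mon_mem rfl)
  -- the shape of the operations, for degree reasons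
  obtain ⟨a, b, c, h0⟩ : ∃ a b c : ZMod 2,
      S.op (Sq 4) (e 0) = a • rho (e 3) + b • rho (e 4) + c • tau (e 5) := by
    have h := eq_sum_of_mem (m4 0) {(0, 1, 3), (0, 1, 4), (1, 0, 5)} fun k l i h => by
      fin_cases i <;> simp [degree, topDegree, weight] at h ⊢ <;> omega
    exact ⟨_, _, _, h.trans (by simp [e, add_assoc]; rfl)⟩
  obtain ⟨a', b', h1⟩ : ∃ a b : ZMod 2, S.op (Sq 4) (e 1) = a • e 6 + b • rho (e 5) := by
    have h := eq_sum_of_mem (m4 1) {(0, 0, 6), (0, 1, 5)} fun k l i h => by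
      fin_cases i <;> simp [degree, topDegree, weight] at h ⊢ <;> omega
    exact ⟨_, _, h.trans (by simp [e]; rfl)⟩
  obtain ⟨a2, b2, c2, h2⟩ : ∃ a b c : ZMod 2,
      S.op (Sq 4) (e 2) = a • tau (e 7) + b • rho (e 6) + c • rho (rho (e 5)) := by
    have h := eq_sum_of_mem (m4 2) {(1, 0, 7), (0, 1, 6), (0, 2, 5)} fun k l i h => by
      fin_cases i <;> simp [degree, topDegree, weight] at h ⊢ <;> omega
    exact ⟨_, _, _, h.trans (by simp [e, add_assoc]; rfl)⟩
  obtain ⟨a3, h3⟩ : ∃ a : ZMod 2, S.op (Sq 4) (e 3) = a • rho (e 7) := by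
    have h := eq_sum_of_mem (m4 3) {(0, 1, 7)} fun k l i h => by
      fin_cases i <;> simp [degree, topDegree, weight] at h ⊢ <;> omega
    exact ⟨_, h.trans (by simp [e]; rfl)⟩
  obtain ⟨a4, h4⟩ : ∃ a : ZMod 2, S.op (Sq 4) (e 4) = a • rho (e 7) := by
    have h := eq_sum_of_mem (m4 4) {(0, 1, 7)} fun k l i h => by
      fin_cases i <;> simp [degree, topDegree, weight] at h ⊢ <;> omega
    exact ⟨_, h.trans (by simp [e]; rfl)⟩
  obtain ⟨a8, h8⟩ : ∃ a : ZMod 2, S.op (Sq 8) (e 0) = a • rho (rho (e 7)) := by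
    have h := eq_sum_of_mem m8 {(0, 2, 7)} fun k l i h => by
      fin_cases i <;> simp [degree, topDegree, weight] at h ⊢ <;> omega
    exact ⟨_, h.trans (by simp [e]; rfl)⟩
  have h5 : S.op (Sq 4) (e 5) = 0 := mem_zero_of_raises (S.raises_op (mem 4)) (by decide)
  -- the Adem relations on the generator
  have r1 := LinearMap.congr_fun (congrArg S.op Sq_two_mul_Sq_three) (e 0)
  have r2 := LinearMap.congr_fun (congrArg S.op Sq_four_mul_Sq_three) (e 0)
  have r3 := LinearMap.congr_fun (congrArg S.op Sq_four_mul_Sq_four) (e 0)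
  simp [f1, f2, f3, f5, f6, f7, fr, ft, even_e, evenValue, sq1Value, sq1_tau, sq1_rho, even_tau,
    even_rho, h0, h1, h2, h3, h4, h5, r, t] at r1 r2 r3
  have u1 := DFunLike.congr_fun r1 (0, 0, 6)
  have u2 := DFunLike.congr_fun r1 (0, 1, 5)
  have u3 := DFunLike.congr_fun r2 (0, 1, 7)
  have u4 := DFunLike.congr_fun r3 (0, 2, 7)
  simp [e] at u1 u2 u3 u4
  simp [mon] at u1 u2 u3 u4
  obtain rfl : a' = 1 := u1.symm
  obtain rfl : c = 1 + b + b' := by clear * - u2; revert b c b'; decide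
  subst u3 u4
  refine ⟨![a, b, b', a8, b2, a2, a4], S.listed_iff.2 <| eq_action _ ft fr
    (S.op_coe _ AR1.sq1) (S.op_coe _ AR1.sq2) (fun n => S.raises_op (mem n)) (fun i hi => ?_) ?_⟩
  · obtain rfl | rfl | rfl | rfl | rfl : i = 0 ∨ i = 1 ∨ i = 2 ∨ i = 3 ∨ i = 4 := by
      revert i; decide
    · rw [h0]; simp [evenValue]; module
    · rw [h1]; simp [evenValue]
    · rw [h2]; simp [evenValue]; module
    · rw [h3]; simp [evenValue]; module
    · rw [h4]; simp [evenValue]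
  · rw [h8]; simp [evenValue]

end ModuleStructure
/-! ### Existence and isomorphisms of the listed structures -/

open Free8
open AR1 (coord)

/-- The model with parameters `v` is free on its first generator, so it transports to
`𝒜^ℝ(1)`. -/
lemma exists_structure_listed (v : Fin 7 → ZMod 2) : ∃ S : ModuleStructure, Listed v S := by
  have hev : (fun a : AR1 => (a : AR) • (show Model v from e 0)) = coord :=
    funext fun a => AR1.evalModel_eq_coord v a
  obtain ⟨S, hS, -⟩ := exists_moduleStructure (Model.isBigraded v) (s := 0)
    (g := (show Model v from e 0)) (mon_mem (d := 0) (by decide)) (hev ▸ coord.bijective)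
  refine ⟨S, S.listed_iff.2 <| AlgHom.ext fun a => LinearMap.ext fun x => ?_⟩
  obtain ⟨x, rfl⟩ := coord.surjective x
  rw [S.op_coord, ← AR1.evalModel_eq_coord v, ← AR1.evalModel_eq_coord v]
  exact hS a x

/-- The only nonzero element of `𝒜^ℝ(1)` of bidegree `(0, 0)` is `1`. -/
lemma AR1.eq_one_of_mem_homogeneous_zero {x : AR1} (hx : x ∈ AR1.homogeneous 0) (h0 : x ≠ 0) :
    x = 1 := by
  have h := eq_sum_of_mem (mem_homogeneous_iff.1 hx) {(0, 0, 0)} fun k l i h => by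
    fin_cases i <;> simp [degree, topDegree, weight] at h ⊢ <;> omega
  rw [Finset.sum_singleton] at h
  have c0 : coord (1 : AR1) = e 0 := AR1.coord_basis 0
  generalize coord x (0, 0, 0) = c at h
  obtain rfl | rfl : c = 0 ∨ c = 1 := by clear h; revert c; decide
  · exact absurd (coord.injective (h.trans (by simp))) h0
  · exact coord.injective (h.trans (by rw [c0, one_smul]; rfl))

/-- An isomorphism preserves the generator, which is the only nonzero element of its bidegree, and
so is the identity. -/
lemma ModuleStructure.eq_of_isoSuspension {S T : ModuleStructure}
    (h : IsoSuspension 0 S.grading T.grading) : S = T := by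
  obtain ⟨f, hf⟩ := h
  have map_act (a : AR) (x : AR1) : f (S.act a x) = T.act a (f x) := f.map_smul a x
  have h1 : f (1 : AR1) = (1 : AR1) := by
    refine AR1.eq_one_of_mem_homogeneous_zero ((hf 0 (1 : AR1)).1 one_mem_homogeneous) fun h => ?_
    have h01 : (1 : AR1) = 0 := f.injective (h.trans f.map_zero.symm)
    have c0 : coord (1 : AR1) = e 0 := AR1.coord_basis 0
    rw [h01, map_zero] at c0
    simpa [e, mon] using DFunLike.congr_fun c0 (0, 0, 0)
  have hid (x : AR1) : f x = x := by
    have := map_act x 1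
    rw [S.act_coe, mul_one, h1, T.act_coe, mul_one] at this
    exact this
  refine ext_op <| AlgHom.ext fun a => LinearMap.ext fun x => ?_
  obtain ⟨x, rfl⟩ := coord.surjective x
  rw [op_coord, op_coord, ← hid (S.act a x), map_act, hid]

end RMotivic

theorem theorem1p4 :
    -- the eight elements form a basis over the coefficients, with the standard `Sq^1`, `Sq^2`
    (RMotivic.IsCoefficientBasis RMotivic.AR1.basis ∧
      RMotivic.AR1.sq2 * RMotivic.AR1.x21 = RMotivic.AR1.τ * RMotivic.AR1.y41 ∧
      RMotivic.AR1.sq2 * RMotivic.AR1.y41 = RMotivic.AR1.y62) ∧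
    -- each vector determines exactly one module structure
    (∀ v : Fin 7 → ZMod 2, ∃! S : RMotivic.ModuleStructure, RMotivic.Listed v S) ∧
    -- different vectors give non-isomorphic modules
    (∀ (v w : Fin 7 → ZMod 2) (S T : RMotivic.ModuleStructure),
      RMotivic.Listed v S → RMotivic.Listed w T →
      RMotivic.IsoSuspension 0 S.grading T.grading → v = w) ∧
    -- every module that is free on one generator over the subalgebra is listed
    (∀ (M : Type*) [AddCommGroup M] [Module RMotivic.AR M] (ℳ : ℤ × ℤ → AddSubgroup M)
      (s : ℤ × ℤ), RMotivic.IsBigraded ℳ → RMotivic.IsFreeOnOneGenerator ℳ s →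
      ∃ (v : Fin 7 → ZMod 2) (S : RMotivic.ModuleStructure),
        RMotivic.Listed v S ∧ RMotivic.IsoSuspension s S.grading ℳ) := by
  refine ⟨⟨RMotivic.AR1.isCoefficientBasis, RMotivic.AR1.sq2_mul_basis 2,
    RMotivic.AR1.sq2_mul_basis 5⟩, fun v => ?_, fun v w S T hS hT h => ?_, ?_⟩
  · obtain ⟨S, hS⟩ := RMotivic.exists_structure_listed v
    exact ⟨S, hS, fun T hT => RMotivic.ModuleStructure.ext_op
      ((T.listed_iff.1 hT).trans (S.listed_iff.1 hS).symm)⟩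
  · obtain rfl := RMotivic.ModuleStructure.eq_of_isoSuspension h
    exact RMotivic.Free8.action_injective ((S.listed_iff.1 hS).symm.trans (S.listed_iff.1 hT))
  · rintro M _ _ ℳ s hM ⟨g, hg, hb⟩
    obtain ⟨S, -, hS⟩ := RMotivic.exists_moduleStructure hM hg hb
    obtain ⟨v, hv⟩ := S.exists_listed
    exact ⟨v, S, hv, hS⟩
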